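/- A polyline drawing of a finite simple graph represents the vertices by distinct points of the plane and every edge by a simple polyline that joins its two endpoints and contains no other vertex, such that any two distinct edges meet only at common endpoints and at proper crossings, i.e. at points that are interior to a segment of each of the two edges, these two segments not being parallel (adjacent edges may cross, and two edges may cross more than once). For $k\ge 0$, a $k$-bend apRAC (axis-parallel right-angle-crossing) drawing is a polyline drawing in which every edge has at most $k$ bends, any two crossing edge segments are perpendicular, and every edge segment involved in a crossing is axis-parallel, i.e. horizontal or vertical. A $k$-bend apRAC graph is a finite simple graph that admits a $k$-bend apRAC drawing. **Theorem.** Every $1$-bend apRAC graph with $n\ge 2$ vertices has at most $5n-8$ edges. Moreover, there is an infinite family of $1$-bend apRAC graphs with exactly $5n-16$ edges, where $n$ is the number of vertices; that is, such $n$-vertex graphs exist for infinitely many $n$. -/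

import Mathlib

/-- A polyline drawing of a simple graph `G` in the plane: vertices are distinct points, and every
edge is a simple polyline joining its two endpoints and avoiding all other vertices. Any two
distinct edges meet only at common endpoints and at proper crossings, that is, at points interior
to a segment of either edge, the two segments not being parallel. Adjacent edges may cross, and two
edges may cross more than once. -/
structure PolylineDrawing {V : Type*} (G : SimpleGraph V) where
  /-- the position of a vertex -/
  pos : V → ℝ × ℝ
  pos_injective : Function.Injective pos
  /-- the endpoint of an edge at which its polyline starts -/
  src : G.edgeSet → V
  /-- the endpoint of an edge at which its polyline ends -/
  tgt : G.edgeSet → V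
  edge_eq : ∀ e : G.edgeSet, (e : Sym2 V) = s(src e, tgt e)
  /-- the number of bends of an edge -/
  numBends : G.edgeSet → ℕ
  /-- the corners of the polyline of an edge: start point, bends in order, end point -/
  pt : (e : G.edgeSet) → Fin (numBends e + 2) → ℝ × ℝ
  pt_zero : ∀ e, pt e 0 = pos (src e)
  pt_last : ∀ e, pt e (Fin.last (numBends e + 1)) = pos (tgt e)
  /-- no edge segment is degenerate -/
  pt_ne : ∀ (e : G.edgeSet) (i : Fin (numBends e + 1)), pt e i.castSucc ≠ pt e i.succ
  /-- every edge is a simple curve: two of its segments meet only if they are consecutive, and then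
  only in the bend between them -/
  simple : ∀ (e : G.edgeSet) (i j : Fin (numBends e + 1)), i < j →
    ∀ x ∈ segment ℝ (pt e i.castSucc) (pt e i.succ),
      x ∈ segment ℝ (pt e j.castSucc) (pt e j.succ) →
        i.succ = j.castSucc ∧ x = pt e i.succ
  /-- an edge contains no vertices but its endpoints -/
  vertex_mem : ∀ (e : G.edgeSet) (i : Fin (numBends e + 1)) (v : V),
    pos v ∈ segment ℝ (pt e i.castSucc) (pt e i.succ) → v ∈ (e : Sym2 V)
  /-- distinct edges meet only at common endpoints and at proper crossings -/
  inter : ∀ (e f : G.edgeSet), e ≠ f →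
    ∀ (i : Fin (numBends e + 1)) (j : Fin (numBends f + 1)),
    ∀ x ∈ segment ℝ (pt e i.castSucc) (pt e i.succ),
      x ∈ segment ℝ (pt f j.castSucc) (pt f j.succ) →
        (∃ v, v ∈ (e : Sym2 V) ∧ v ∈ (f : Sym2 V) ∧ x = pos v) ∨
        (x ∈ openSegment ℝ (pt e i.castSucc) (pt e i.succ) ∧
          x ∈ openSegment ℝ (pt f j.castSucc) (pt f j.succ) ∧
          ((pt e i.succ).1 - (pt e i.castSucc).1) * ((pt f j.succ).2 - (pt f j.castSucc).2) ≠
            ((pt e i.succ).2 - (pt e i.castSucc).2) * ((pt f j.succ).1 - (pt f j.castSucc).1))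

namespace PolylineDrawing

variable {V : Type*} {G : SimpleGraph V} (D : PolylineDrawing G)

/-- Every edge has at most `k` bends. -/
def IsBend (k : ℕ) : Prop :=
  ∀ e, D.numBends e ≤ k

/-- The `i`-th segment of the edge `e` and the `j`-th segment of the edge `f` cross: the two edges
are distinct and the segments share a point interior to both of them. -/
def Crosses (e f : G.edgeSet) (i : Fin (D.numBends e + 1)) (j : Fin (D.numBends f + 1)) : Prop :=
  e ≠ f ∧ (openSegment ℝ (D.pt e i.castSucc) (D.pt e i.succ) ∩
    openSegment ℝ (D.pt f j.castSucc) (D.pt f j.succ)).Nonempty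

/-- A segment is axis-parallel if it is horizontal or vertical. -/
def AxisParallel (e : G.edgeSet) (i : Fin (D.numBends e + 1)) : Prop :=
  (D.pt e i.castSucc).2 = (D.pt e i.succ).2 ∨ (D.pt e i.castSucc).1 = (D.pt e i.succ).1

/-- Right-angle crossings: any two crossing edge segments are perpendicular. -/
def IsRAC : Prop :=
  ∀ e f i j, D.Crosses e f i j →
    ((D.pt e i.succ).1 - (D.pt e i.castSucc).1) * ((D.pt f j.succ).1 - (D.pt f j.castSucc).1) +
      ((D.pt e i.succ).2 - (D.pt e i.castSucc).2) * ((D.pt f j.succ).2 - (D.pt f j.castSucc).2) = 0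

/-- Axis-parallel RAC drawing: a RAC drawing in which all edge segments involved in crossings are
axis-parallel. -/
def IsApRAC : Prop :=
  D.IsRAC ∧ ∀ e f i j, D.Crosses e f i j → D.AxisParallel e i ∧ D.AxisParallel f j

end PolylineDrawing

/-- `G` is a `k`-bend apRAC graph: it admits a `k`-bend axis-parallel RAC drawing. -/
def IsBendApRAC (k : ℕ) {V : Type*} (G : SimpleGraph V) : Prop :=
  ∃ D : PolylineDrawing G, D.IsBend k ∧ D.IsApRAC

/-! Upper bound. Crossing segments are perpendicular and axis-parallel, so every crossing involves a
vertical segment. Deleting all edges with a crossed vertical segment leaves a plane drawing, with at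
most `3n - 6` edges for `n ≥ 3`. With at most one bend per edge, every segment ends at a vertex, so
a deleted edge leaves some vertex `v` vertically, and each of the `2n` upward and downward ports
serves at most one such edge. The horizontal segment that crosses it also ends at a vertex, whose
height is that of the crossing. Hence the upward port of a highest vertex and the downward port of a
lowest one stay unused: at most `2n - 2` edges are deleted (`ncard_verticallyCrossed_le`), and `(3n
- 6) + (2n - 2) = 5n - 8`.

The planar bound needs no faces and no Jordan curve theorem. A plane drawing yields the parities
`CrossingParity` of crossings of edges with vertical rays at vertices. Such data rule out a complete
graph on five vertices (`not_complete_five`) and survive deletion and contraction of edges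
(`CrossingParity.contractInto`). The classical induction for graphs without a `K₅` minor then gives
`3n - 6` (`card_edgeFinset_add_six_le`).

Lower bound. Each of `k + 1` vertices on a diagonal sends horizontal and vertical segments in all
four directions, which cross only one another, inside a square. Outside it they bend towards four
poles. With the `k` edges of the diagonal path and five edges between poles drawn around the square,
`n = k + 5` and there are `k + 4(k + 1) + 5 = 5n - 16` edges. -/

/-! ### Crossing parities and the complete graph on five vertices. -/

/-- Mod 2 crossing data of a crossing-free drawing of `G`: `r a b p` and `s a b p` count the
crossings of the edge `ab` with the upward and the downward ray at `p`, and `c` is the order of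
the vertices from left to right. -/
structure CrossingParity {V : Type*} (G : SimpleGraph V) (r s : V → V → V → ZMod 2)
    (c : V → V → ZMod 2) : Prop where
  line : ∀ a b p, G.Adj a b → p ≠ a → p ≠ b → r a b p + s a b p = c p a + c p b
  link : ∀ a b x y, G.Adj a b → G.Adj x y → a ≠ x → a ≠ y → b ≠ x → b ≠ y →
    r a b x + r a b y + s x y a + s x y b = 0
  total : ∀ p q, p ≠ q → c p q + c q p = 1

namespace CrossingParity

variable {V : Type*} {G : SimpleGraph V} {r s : V → V → V → ZMod 2} {c : V → V → ZMod 2}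

theorem mono (h : CrossingParity G r s c) {H : SimpleGraph V} (hH : H ≤ G) :
    CrossingParity H r s c :=
  ⟨fun a b p hab => h.line a b p (hH hab), fun a b x y hab hxy => h.link a b x y (hH hab) (hH hxy),
    h.total⟩

/-- Eliminates the downward counts `s`. When `c` is a left-to-right order, the right side is 1
exactly if the pairs `a, b` and `x, y` interleave. -/
theorem interleave (h : CrossingParity G r s c) {a b x y : V} (hab : G.Adj a b) (hxy : G.Adj x y)
    (hax : a ≠ x) (hay : a ≠ y) (hbx : b ≠ x) (hby : b ≠ y) :
    r a b x + r a b y + r x y a + r x y b = c a x + c a y + c b x + c b y := by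
  have h1 := h.link a b x y hab hxy hax hay hbx hby
  have h2 := h.line x y a hxy hax hay
  have h3 := h.line x y b hxy hbx hby
  grind

/-- Add `interleave` over the 15 pairs of disjoint edges. On the left, each edge-vertex term occurs
twice and cancels. On the right, each of the five 4-subsets contributes 1 through its three
pairings, by `total`; so the sum is odd. -/
theorem not_complete_five (h : CrossingParity G r s c) {v₀ v₁ v₂ v₃ v₄ : V}
    (h01 : G.Adj v₀ v₁) (h02 : G.Adj v₀ v₂) (h03 : G.Adj v₀ v₃) (h04 : G.Adj v₀ v₄)
    (h12 : G.Adj v₁ v₂) (h13 : G.Adj v₁ v₃) (h14 : G.Adj v₁ v₄)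
    (h23 : G.Adj v₂ v₃) (h24 : G.Adj v₂ v₄) (h34 : G.Adj v₃ v₄) : False := by
  have n01 := h01.ne; have n02 := h02.ne; have n03 := h03.ne; have n04 := h04.ne
  have n12 := h12.ne; have n13 := h13.ne; have n14 := h14.ne
  have n23 := h23.ne; have n24 := h24.ne; have n34 := h34.ne
  have e1 := h.interleave h12 h34 n13 n14 n23 n24
  have e2 := h.interleave h13 h24 n12 n14 n23.symm n34
  have e3 := h.interleave h14 h23 n12 n13 n24.symm n34.symm
  have e4 := h.interleave h02 h34 n03 n04 n23 n24
  have e5 := h.interleave h03 h24 n02 n04 n23.symm n34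
  have e6 := h.interleave h04 h23 n02 n03 n24.symm n34.symm
  have e7 := h.interleave h01 h34 n03 n04 n13 n14
  have e8 := h.interleave h03 h14 n01 n04 n13.symm n34
  have e9 := h.interleave h04 h13 n01 n03 n14.symm n34.symm
  have e10 := h.interleave h01 h24 n02 n04 n12 n14
  have e11 := h.interleave h02 h14 n01 n04 n12.symm n24
  have e12 := h.interleave h04 h12 n01 n02 n14.symm n24.symm
  have e13 := h.interleave h01 h23 n02 n03 n12 n13
  have e14 := h.interleave h02 h13 n01 n03 n12.symm n23
  have e15 := h.interleave h03 h12 n01 n02 n13.symm n23.symm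
  have t12 := h.total _ _ n12
  have t13 := h.total _ _ n13
  have t14 := h.total _ _ n14
  have t23 := h.total _ _ n23
  have t24 := h.total _ _ n24
  have t34 := h.total _ _ n34
  clear n01 n02 n03 n04 n12 n13 n14 n23 n24 n34 h01 h02 h03 h04 h12 h13 h14 h23 h24 h34 h
  grind

end CrossingParity

/-! ### Edge counts under contraction and vertex deletion. -/

namespace SimpleGraph

variable {V : Type*}

/-- Contraction of `v` into `u`; the vertex `v` stays as an isolated vertex. -/
def contractInto (G : SimpleGraph V) (u v : V) : SimpleGraph V where
  Adj x y := x ≠ v ∧ y ≠ v ∧ x ≠ y ∧ (G.Adj x y ∨ (x = u ∧ G.Adj v y) ∨ (y = u ∧ G.Adj v x))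
  symm := ⟨fun _ _ h => ⟨h.2.1, h.1, h.2.2.1.symm, h.2.2.2.imp (fun h => h.symm) Or.symm⟩⟩
  loopless := ⟨fun _ h => h.2.2.1 rfl⟩

open Classical in
-- Contracting `uv` loses that edge and, for each common neighbour, one of two edges that become
-- equal.
theorem card_edgeFinset_le_contractInto [Fintype V] (G : SimpleGraph V) {u v : V}
    (huv : G.Adj u v) :
    G.edgeFinset.card ≤
      (G.contractInto u v).edgeFinset.card + 1 + (G.neighborFinset u ∩ G.neighborFinset v).card := by
  -- `new` collects the edges at `u` that the contraction creates: those to neighbours of `v` alone.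
  set A := (G.neighborFinset v \ G.neighborFinset u).erase u with hA
  set new := A.image (fun y => s(u, y)) with hnew
  have hinj : ∀ w : V, Function.Injective (fun y : V => s(w, y)) := fun _ _ _ h => Sym2.congr_right.1 h
  have hnewcard : new.card = A.card := Finset.card_image_of_injective _ (hinj u)
  have hsub : G.edgeFinset ⊆ ((G.contractInto u v).edgeFinset \ new) ∪
      (G.neighborFinset v).image (fun y => s(v, y)) := by
    intro e
    induction e using Sym2.ind with
    | _ x y =>
      intro he
      rw [mem_edgeFinset, mem_edgeSet] at he
      by_cases hx : x = v
      · subst hx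
        exact Finset.mem_union_right _ (Finset.mem_image.2 ⟨y, by simpa using he, rfl⟩)
      by_cases hy : y = v
      · subst hy
        exact Finset.mem_union_right _ (Finset.mem_image.2 ⟨x, by simpa using he.symm, Sym2.eq_swap⟩)
      refine Finset.mem_union_left _ (Finset.mem_sdiff.2 ⟨?_, ?_⟩)
      · rw [mem_edgeFinset, mem_edgeSet]
        exact ⟨hx, hy, he.ne, Or.inl he⟩
      · intro h
        obtain ⟨z, hz, hzz⟩ := Finset.mem_image.1 h
        have hz' : ¬ G.Adj u z := by
          have := (Finset.mem_sdiff.1 (Finset.mem_of_mem_erase hz)).2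
          simpa using this
        have : s(u, z) ∈ G.edgeSet := by
          rw [hzz]; exact he
        exact hz' this
  have hnewsub : new ⊆ (G.contractInto u v).edgeFinset := by
    intro e he
    obtain ⟨z, hz, rfl⟩ := Finset.mem_image.1 he
    have hzu := (Finset.mem_erase.1 hz).1
    have hvz : G.Adj v z := by
      have := (Finset.mem_sdiff.1 (Finset.mem_of_mem_erase hz)).1
      simpa using this
    rw [mem_edgeFinset, mem_edgeSet]
    exact ⟨huv.ne, hvz.ne', Ne.symm hzu, Or.inr (Or.inl ⟨rfl, hvz⟩)⟩
  have h1 := (Finset.card_le_card hsub).trans (Finset.card_union_le _ _)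
  rw [Finset.card_sdiff_of_subset hnewsub, Finset.card_image_of_injective _ (hinj v), hnewcard] at h1
  have h2 := Finset.card_le_card hnewsub
  have hu : u ∈ G.neighborFinset v \ G.neighborFinset u := by simp [huv.symm]
  have h3 : A.card + 1 = (G.neighborFinset v \ G.neighborFinset u).card :=
    Finset.card_erase_add_one hu
  have h4 := Finset.card_sdiff_add_card_inter (G.neighborFinset v) (G.neighborFinset u)
  rw [Finset.inter_comm] at h4
  omega

open Classical in
theorem card_edgeFinset_le_delete_vertex [Fintype V] (G : SimpleGraph V) (v : V) :
    G.edgeFinset.card ≤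
      (G.deleteIncidenceSet v).edgeFinset.card + G.degree v := by
  rw [card_edgeFinset_deleteIncidenceSet]
  omega

end SimpleGraph

/-! ### Contraction preserves crossing parities. -/

namespace CrossingParity

variable {V : Type*} {G : SimpleGraph V} {r s : V → V → V → ZMod 2} {c : V → V → ZMod 2}

open Classical in
-- An edge `uy` created by the contraction is routed as the path `u, v, y`, and its counts are the
-- sums along that path. In `line` and `link` the terms at the intermediate vertex `v` occur twice
-- and cancel.
theorem contractInto (h : CrossingParity G r s c) {u v : V} (huv : G.Adj u v) :
    ∃ r' s', CrossingParity (G.contractInto u v) r' s' c := by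
  -- The isolated vertex `v` still has to satisfy `line`; the values at `p = v` are chosen for this
  -- alone.
  refine ⟨fun x y p => if p = v then 0 else if G.Adj x y then r x y p else
      if x = u then r u v p + r v y p else r x v p + r v u p,
    fun x y p => if p = v then c p x + c p y else if G.Adj x y then s x y p else
      if x = u then s u v p + s v y p else s x v p + s v u p, ?_, ?_, h.total⟩
  · rintro a b p ⟨hav, hbv, hab, had⟩ hpa hpb
    by_cases hp : p = v
    · simp [hp]
    simp only [hp, if_false]
    have hvu := huv.symm
    split_ifs with h1 h2
    · exact h.line a b p h1 hpa hpb
    · subst h2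
      have hvb : G.Adj v b := by
        rcases had with h3 | h3 | h3
        · exact absurd h3 h1
        · exact h3.2
        · exact absurd h3.1 hab.symm
      have e1 := h.line a v p huv hpa hp
      have e2 := h.line v b p hvb hp hpb
      grind
    · have hvb : b = u ∧ G.Adj v a := by
        rcases had with h3 | h3 | h3
        · exact absurd h3 h1
        · exact absurd h3.1 h2
        · exact h3
      obtain ⟨rfl, hva⟩ := hvb
      have e1 := h.line a v p hva.symm hpa hp
      have e2 := h.line v b p hvu hp hpb
      grind
  · rintro a b x y ⟨hav, hbv, hab, had⟩ ⟨hxv, hyv, hxy, hxd⟩ hax hay hbx hby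
    simp only [hav, hbv, hxv, hyv, if_false]
    have hvu := huv.symm
    have key : ∀ a b, a ≠ v → b ≠ v → a ≠ b → ¬ G.Adj a b →
        (G.Adj a b ∨ (a = u ∧ G.Adj v b) ∨ (b = u ∧ G.Adj v a)) →
        (a = u ∧ G.Adj v b) ∨ (a ≠ u ∧ b = u ∧ G.Adj a v) := by
      intro a b _ _ hab h1 h2
      rcases h2 with h2 | h2 | h2
      · exact absurd h2 h1
      · exact Or.inl h2
      · exact Or.inr ⟨fun h => hab (h.trans h2.1.symm), h2.1, h2.2.symm⟩
    by_cases h1 : G.Adj a b <;> by_cases h2 : G.Adj x y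
    · simp only [h1, h2, if_true]
      exact h.link a b x y h1 h2 hax hay hbx hby
    · simp only [h1, h2, if_true, if_false]
      rcases key x y hxv hyv hxy h2 hxd with ⟨rfl, h3⟩ | ⟨h5, rfl, h3⟩
      · have e1 := h.link a b x v h1 huv hax hav hbx hbv
        have e2 := h.link a b v y h1 h3 hav hay hbv hby
        simp only [if_true]
        grind
      · have e1 := h.link a b x v h1 h3 hax hav hbx hbv
        have e2 := h.link a b v y h1 hvu hav hay hbv hby
        simp only [h5, if_false]
        grind
    · simp only [h1, h2, if_true, if_false]
      rcases key a b hav hbv hab h1 had with ⟨rfl, h3⟩ | ⟨h5, rfl, h3⟩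
      · have e1 := h.link a v x y huv h2 hax hay hxv.symm hyv.symm
        have e2 := h.link v b x y h3 h2 hxv.symm hyv.symm hbx hby
        simp only [if_true]
        grind
      · have e1 := h.link a v x y h3 h2 hax hay hxv.symm hyv.symm
        have e2 := h.link v b x y hvu h2 hxv.symm hyv.symm hbx hby
        simp only [h5, if_false]
        grind
    -- Two created edges share the vertex `u`, so they are not disjoint.
    · exfalso
      rcases key x y hxv hyv hxy h2 hxd with ⟨rfl, h3⟩ | ⟨h5, rfl, h3⟩ <;>
      rcases key a b hav hbv hab h1 had with ⟨rfl, h4⟩ | ⟨h6, rfl, h4⟩ <;> contradiction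

end CrossingParity

/-! ### At most `3n - 6` edges. -/

namespace CrossingParity

variable {V : Type*} {G : SimpleGraph V} {r s : V → V → V → ZMod 2} {c : V → V → ZMod 2}

/-- If `v` has five neighbours, each of which has at least three neighbours among the others, then
contracting an edge between two of them leaves a complete graph on five vertices. -/
theorem not_adj_of_five_neighbors (h : CrossingParity G r s c) {v a b x y z : V}
    (hab : a ≠ b) (hva : G.Adj v a) (hvb : G.Adj v b) (hvx : G.Adj v x) (hvy : G.Adj v y)
    (hvz : G.Adj v z) (hax : G.Adj a x) (hay : G.Adj a y) (haz : G.Adj a z)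
    (hbx : G.Adj b x) (hby : G.Adj b y) (hbz : G.Adj b z) (hxy : x ≠ y) (hyz : G.Adj y z)
    (hxz : x ≠ z) : False := by
  obtain ⟨r', s', h'⟩ := h.contractInto hax
  have keep : ∀ p q, G.Adj p q → p ≠ x → q ≠ x → (G.contractInto a x).Adj p q :=
    fun p q hpq hp hq => ⟨hp, hq, hpq.ne, Or.inl hpq⟩
  refine h'.not_complete_five (v₀ := v) (v₁ := a) (v₂ := b) (v₃ := y) (v₄ := z)
    (keep _ _ hva hvx.ne hax.ne) (keep _ _ hvb hvx.ne hbx.ne) (keep _ _ hvy hvx.ne hxy.symm)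
    (keep _ _ hvz hvx.ne hxz.symm) ⟨hax.ne, hbx.ne, hab, Or.inr (Or.inl ⟨rfl, hbx.symm⟩)⟩
    (keep _ _ hay hax.ne hxy.symm) (keep _ _ haz hax.ne hxz.symm) (keep _ _ hby hbx.ne hxy.symm)
    (keep _ _ hbz hbx.ne hxz.symm) (keep _ _ hyz hxy.symm hxz.symm)

open Classical in
-- The neighbourhood of `v` has four or five vertices and minimum degree at least 3. If it contains
-- all edges, `v` lies in a `K₅`. Otherwise it has five vertices, each missing at most one other,
-- and `not_adj_of_five_neighbors` applies to a nonadjacent pair.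
theorem not_low_degree [Fintype V] (h : CrossingParity G r s c) {v : V} (h4 : 4 ≤ G.degree v)
    (h5 : G.degree v ≤ 5)
    (hcom : ∀ w, G.Adj v w → 3 ≤ (G.neighborFinset v ∩ G.neighborFinset w).card) : False := by
  have hmem : ∀ w, w ∈ G.neighborFinset v ↔ G.Adj v w := fun w => by simp
  have hcard : (G.neighborFinset v).card = G.degree v := rfl
  set N := G.neighborFinset v with hN
  -- few neighbours of `v` are not adjacent to a given one
  have hnon : ∀ w, G.Adj v w → ((N.erase w).filter fun x => ¬ G.Adj w x).card + 4 ≤ N.card := by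
    intro w hw
    have h1 := hcom w hw
    have h2 : N ∩ G.neighborFinset w = (N.erase w).filter fun x => G.Adj w x := by
      ext x
      simp only [Finset.mem_inter, Finset.mem_filter, Finset.mem_erase, SimpleGraph.mem_neighborFinset]
      exact ⟨fun h => ⟨⟨h.2.ne', h.1⟩, h.2⟩, fun h => ⟨h.1.2, h.2⟩⟩
    rw [h2] at h1
    have h3 := Finset.card_filter_add_card_filter_not (s := N.erase w) (fun x => G.Adj w x)
    have h4 := Finset.card_erase_add_one ((hmem w).2 hw)
    omega
  have huniq : ∀ w x y, G.Adj v w → G.Adj v x → G.Adj v y → x ≠ w → y ≠ w → x ≠ y →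
      ¬ G.Adj w x → G.Adj w y := by
    intro w x y hw hx hy hxw hyw hxy hwx
    by_contra hwy
    have h1 : ({x, y} : Finset V) ⊆ (N.erase w).filter fun x => ¬ G.Adj w x := by
      intro t ht
      simp only [Finset.mem_insert, Finset.mem_singleton] at ht
      rcases ht with rfl | rfl
      · simp [hxw, hmem, hx, hwx]
      · simp [hyw, hmem, hy, hwy]
    have h2 := Finset.card_le_card h1
    rw [Finset.card_pair hxy] at h2
    have := hnon w hw
    omega
  by_cases hall : ∀ a b, G.Adj v a → G.Adj v b → a ≠ b → G.Adj a b
  · obtain ⟨T, hT, hT4⟩ := Finset.exists_subset_card_eq (s := N) (n := 4) (by omega)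
    obtain ⟨a, b, x, y, hab, hax, hay, hbx, hby, hxy, rfl⟩ := Finset.card_eq_four.1 hT4
    have ha := (hmem a).1 (hT (by simp))
    have hb := (hmem b).1 (hT (by simp))
    have hx := (hmem x).1 (hT (by simp))
    have hy := (hmem y).1 (hT (by simp))
    exact h.not_complete_five ha hb hx hy (hall _ _ ha hb hab) (hall _ _ ha hx hax)
      (hall _ _ ha hy hay) (hall _ _ hb hx hbx) (hall _ _ hb hy hby) (hall _ _ hx hy hxy)
  · push Not at hall
    obtain ⟨a, b, ha, hb, hab, hnab⟩ := hall
    have h5' : N.card = 5 := by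
      have h1 := hnon a ha
      have h2 : 0 < ((N.erase a).filter fun x => ¬ G.Adj a x).card :=
        Finset.card_pos.2 ⟨b, by simp [hab.symm, hmem, hb, hnab]⟩
      omega
    have h3 : ((N.erase a).erase b).card = 3 := by
      rw [Finset.card_erase_of_mem (by simp [hab.symm, hmem, hb]),
        Finset.card_erase_of_mem ((hmem a).2 ha), h5']
    obtain ⟨x, y, z, hxy, hxz, hyz, hT⟩ := Finset.card_eq_three.1 h3
    have hin : ∀ w, w ∈ ({x, y, z} : Finset V) → w ≠ b ∧ w ≠ a ∧ G.Adj v w := by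
      intro w hw
      rw [← hT] at hw
      simpa [hmem] using hw
    obtain ⟨hxb, hxa, hx⟩ := hin x (by simp)
    obtain ⟨hyb, hya, hy⟩ := hin y (by simp)
    obtain ⟨hzb, hza, hz⟩ := hin z (by simp)
    have hA : ∀ w, G.Adj v w → w ≠ a → w ≠ b → G.Adj a w := fun w hw hwa hwb =>
      huniq a b w ha hb hw hab.symm hwa hwb.symm hnab
    have hB : ∀ w, G.Adj v w → w ≠ a → w ≠ b → G.Adj b w := fun w hw hwa hwb =>
      huniq b a w hb ha hw hab hwb hwa.symm fun h => hnab h.symm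
    have fin : ∀ x y z, x ≠ y → x ≠ z → G.Adj v x → G.Adj v y → G.Adj v z → x ≠ a → x ≠ b →
        y ≠ a → y ≠ b → z ≠ a → z ≠ b → G.Adj y z → False :=
      fun x y z hxy hxz hx hy hz hxa hxb hya hyb hza hzb hyz =>
        h.not_adj_of_five_neighbors hab ha hb hx hy hz (hA x hx hxa hxb) (hA y hy hya hyb)
          (hA z hz hza hzb) (hB x hx hxa hxb) (hB y hy hya hyb) (hB z hz hza hzb) hxy hyz hxz
    -- If `y` misses `z`, it misses nothing else, so `x` and `y` are adjacent.
    by_cases hyz' : G.Adj y z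
    · exact fin x y z hxy hxz hx hy hz hxa hxb hya hyb hza hzb hyz'
    · exact fin z y x hyz.symm hxz.symm hz hy hx hza hzb hya hyb hxa hxb
        (huniq y z x hy hz hx hyz.symm hxy hxz.symm hyz')

open Classical in
-- The bound is `3|S| - 6`. The set `S` carries the vertex count because contraction and deletion
-- keep the vertex type and leave isolated vertices behind.
theorem card_edgeFinset_add_six_le [Fintype V] (n : ℕ) :
    ∀ (S : Finset V) (G : SimpleGraph V) (r s : V → V → V → ZMod 2),
      CrossingParity G r s c → S.card = n + 3 → (∀ a b, G.Adj a b → a ∈ S) →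
      G.edgeFinset.card ≤ 3 * n + 3 := by
  have hdeg : ∀ (S : Finset V) (G : SimpleGraph V), (∀ a b, G.Adj a b → a ∈ S) →
      ∑ v ∈ S, G.degree v = 2 * G.edgeFinset.card := by
    intro S G hS
    rw [← G.sum_degrees_eq_twice_card_edges]
    refine Finset.sum_subset (Finset.subset_univ _) fun v _ hv => ?_
    rw [SimpleGraph.degree, Finset.card_eq_zero, Finset.eq_empty_iff_forall_notMem]
    intro w hw
    exact hv (hS v w (by simpa using hw))
  induction n with
  | zero =>
    intro S G r s _ hcard hS
    have h1 := hdeg S G hS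
    have h2 : ∑ v ∈ S, G.degree v ≤ ∑ v ∈ S, 2 := by
      refine Finset.sum_le_sum fun v hv => ?_
      have : G.neighborFinset v ⊆ S.erase v := by
        intro w hw
        have hw' : G.Adj v w := by simpa using hw
        exact Finset.mem_erase.2 ⟨hw'.ne', hS w v hw'.symm⟩
      have h3 := Finset.card_le_card this
      rw [Finset.card_erase_of_mem hv, hcard] at h3
      exact h3
    simp only [Finset.sum_const, hcard, smul_eq_mul] at h2
    omega
  | succ n ih =>
    intro S G₁ r s h₁ hcard hS₁
    by_contra hlt
    -- Keep exactly one edge more than allowed. The lower bound makes every degree at least 4 and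
    -- gives every edge three common neighbours; the upper bound puts the average degree below 6.
    obtain ⟨F, hF, hFc⟩ := Finset.exists_subset_card_eq (s := G₁.edgeFinset) (n := 3 * n + 7)
      (by omega)
    obtain ⟨G, hG, hGc⟩ : ∃ G : SimpleGraph V, G ≤ G₁ ∧ G.edgeFinset.card = 3 * n + 7 := by
      refine ⟨SimpleGraph.fromEdgeSet F, ?_, ?_⟩
      · intro a b hab
        have := hF (by simpa using hab.1)
        simpa using this
      · convert hFc using 2
        ext e
        simp only [SimpleGraph.mem_edgeFinset, SimpleGraph.edgeSet_fromEdgeSet, Set.mem_sdiff,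
          Finset.mem_coe]
        exact ⟨fun h => h.1, fun h => ⟨h, G₁.not_isDiag_of_mem_edgeFinset (hF h)⟩⟩
    have h := h₁.mono hG
    have hS : ∀ a b, G.Adj a b → a ∈ S := fun a b hab => hS₁ a b (hG hab)
    have hmin : ∀ v ∈ S, 4 ≤ G.degree v := by
      intro v hv
      have h1 : (G.deleteIncidenceSet v).edgeFinset.card ≤ 3 * n + 3 := by
        convert ih (S.erase v) (G.deleteIncidenceSet v) r s (h.mono (G.deleteIncidenceSet_le v))
          (by rw [Finset.card_erase_of_mem hv, hcard]; omega) (by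
            intro a b hab
            rw [SimpleGraph.deleteIncidenceSet_adj] at hab
            exact Finset.mem_erase.2 ⟨hab.2.1, hS a b hab.1⟩)
      have h2 := G.card_edgeFinset_le_delete_vertex v
      omega
    have hcom : ∀ u v, G.Adj u v → 3 ≤ (G.neighborFinset u ∩ G.neighborFinset v).card := by
      intro u v huv
      obtain ⟨r', s', h'⟩ := h.contractInto huv
      have h1 := ih (S.erase v) (G.contractInto u v) r' s' h'
        (by rw [Finset.card_erase_of_mem (hS v u huv.symm), hcard]; omega) (by
          rintro a b ⟨ha, hb, hab, h1 | ⟨rfl, h1⟩ | ⟨rfl, h1⟩⟩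
          · exact Finset.mem_erase.2 ⟨ha, hS a b h1⟩
          · exact Finset.mem_erase.2 ⟨ha, hS a v huv⟩
          · exact Finset.mem_erase.2 ⟨ha, hS a v h1.symm⟩)
      have h2 := G.card_edgeFinset_le_contractInto huv
      omega
    obtain ⟨v, hv, hv5⟩ : ∃ v ∈ S, G.degree v < 6 := by
      refine Finset.exists_lt_of_sum_lt ?_
      rw [hdeg S G hS, Finset.sum_const, hcard, smul_eq_mul]
      omega
    exact h.not_low_degree (hmin v hv) (by omega) fun w hw => hcom v w hw

end CrossingParity

/-! ### Disjoint segments and vertical rays. -/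

namespace PlaneSegment

/-- A linear functional on the plane. -/
def lin (ε : ℝ) (p : ℝ × ℝ) : ℝ := p.1 + ε * p.2

/-- The orientation determinant of three points. -/
def det (a b p : ℝ × ℝ) : ℝ := (b.1 - a.1) * (p.2 - a.2) - (b.2 - a.2) * (p.1 - a.1)

/-- A tilted horizontal coordinate removes all coincidences between corners; only finitely many
values of `ε` fail. "Vertical" then means along the level lines of `lin ε`. -/
theorem exists_lin_injOn (T : Set (ℝ × ℝ)) (hT : T.Finite) : ∃ ε, Set.InjOn (lin ε) T := by
  have hfin : ((fun q : (ℝ × ℝ) × (ℝ × ℝ) => -(q.1.1 - q.2.1) / (q.1.2 - q.2.2)) '' (T ×ˢ T)).Finite :=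
    (hT.prod hT).image _
  obtain ⟨ε, hε⟩ := hfin.exists_notMem
  refine ⟨ε, fun p hp q hq hpq => ?_⟩
  simp only [lin] at hpq
  by_cases h2 : p.2 = q.2
  · rw [h2] at hpq
    exact Prod.ext (by linarith) h2
  · exfalso
    refine hε ⟨(p, q), ⟨hp, hq⟩, ?_⟩
    have : p.2 - q.2 ≠ 0 := sub_ne_zero.2 h2
    field_simp
    linarith

theorem mem_segment_of_det_eq_zero {ε : ℝ} {a b p : ℝ × ℝ} (h1 : lin ε a < lin ε p)
    (h2 : lin ε p < lin ε b) (h : det a b p = 0) : p ∈ segment ℝ a b := by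
  have h3 : 0 < lin ε b - lin ε a := by linarith
  refine ⟨(lin ε b - lin ε p) / (lin ε b - lin ε a), (lin ε p - lin ε a) / (lin ε b - lin ε a),
    div_nonneg (by linarith) h3.le, div_nonneg (by linarith) h3.le, by field_simp; ring, ?_⟩
  have h4 : lin ε b - lin ε a ≠ 0 := h3.ne'
  ext
  · simp only [Prod.fst_add, Prod.smul_fst, smul_eq_mul]
    field_simp
    simp only [lin, det] at *
    linear_combination ε * h
  · simp only [Prod.snd_add, Prod.smul_snd, smul_eq_mul]
    field_simp
    simp only [lin, det] at *
    linear_combination - h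

theorem not_disjoint_of_det {a b c d : ℝ × ℝ} (hc : det a b c ≤ 0) (hd : 0 ≤ det a b d)
    (hlt : det a b c < det a b d) (hb : det c d b ≤ 0) (ha : 0 ≤ det c d a) :
    ¬ Disjoint (segment ℝ a b) (segment ℝ c d) := by
  rw [Set.not_disjoint_iff]
  have h0 : det a b d - det a b c = det c d a - det c d b := by simp only [det]; ring
  have hpos : 0 < det a b d - det a b c := by linarith
  have hpos' : 0 < det c d a - det c d b := by linarith
  refine ⟨(det a b d / (det a b d - det a b c)) • c + (-det a b c / (det a b d - det a b c)) • d,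
    ⟨-det c d b / (det c d a - det c d b), det c d a / (det c d a - det c d b),
      div_nonneg (by linarith) hpos'.le, div_nonneg ha hpos'.le, by field_simp; ring, ?_⟩,
    ⟨_, _, div_nonneg hd hpos.le, div_nonneg (by linarith) hpos.le, by field_simp; ring, rfl⟩⟩
  rw [← h0]
  have h4 := hpos.ne'
  ext
  · simp only [Prod.fst_add, Prod.smul_fst, smul_eq_mul]
    field_simp
    simp only [det]
    ring
  · simp only [Prod.snd_add, Prod.smul_snd, smul_eq_mul]
    field_simp
    simp only [det]
    ring

theorem det_swap (a b p : ℝ × ℝ) : det b a p = -det a b p := by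
  simp only [det]; ring

/-- The four determinants, with signs, are the coefficients of an affine dependence between `a, b,
c, d`. Together with `det_relation` this expresses one determinant through two others. -/
theorem lin_relation (ε : ℝ) (a b c d : ℝ × ℝ) :
    lin ε a * det c d b - lin ε b * det c d a + lin ε c * det a b d - lin ε d * det a b c = 0 := by
  simp only [lin, det]; ring

theorem det_relation (a b c d : ℝ × ℝ) :
    det c d b - det c d a + det a b d - det a b c = 0 := by
  simp only [det]; ring

/-- Two points that lie between the ends of a segment disjoint from theirs are on the same side. -/
theorem det_neg_iff_of_nested {ε : ℝ} {a b c d : ℝ × ℝ} (hac : lin ε a < lin ε c)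
    (hcb : lin ε c < lin ε b) (had : lin ε a < lin ε d) (hdb : lin ε d < lin ε b)
    (h : Disjoint (segment ℝ a b) (segment ℝ c d)) : det a b c < 0 ↔ det a b d < 0 := by
  have hc0 : det a b c ≠ 0 := fun h0 => Set.disjoint_left.1 h
    (mem_segment_of_det_eq_zero hac hcb h0) (left_mem_segment ℝ c d)
  have hd0 : det a b d ≠ 0 := fun h0 => Set.disjoint_left.1 h
    (mem_segment_of_det_eq_zero had hdb h0) (right_mem_segment ℝ c d)
  have key : ∀ c d : ℝ × ℝ, lin ε a < lin ε c → lin ε c < lin ε b → lin ε a < lin ε d →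
      lin ε d < lin ε b → Disjoint (segment ℝ a b) (segment ℝ c d) → det a b c < 0 →
      0 < det a b d → False := by
    intro c d hac hcb had hdb h hc hd
    have e1 := lin_relation ε a b c d
    have e2 := det_relation a b c d
    refine not_disjoint_of_det hc.le hd.le (hc.trans hd) ?_ ?_ h
    · have e3 : (lin ε b - lin ε a) * det c d b =
          -(lin ε b - lin ε c) * det a b d + (lin ε b - lin ε d) * det a b c := by
        linear_combination (lin ε b) * e2 - e1
      nlinarith [mul_pos (sub_pos.2 hcb) hd, mul_pos (sub_pos.2 hdb) (neg_pos.2 hc)]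
    · have e3 : (lin ε b - lin ε a) * det c d a =
          (lin ε c - lin ε a) * det a b d - (lin ε d - lin ε a) * det a b c := by
        linear_combination (lin ε a) * e2 - e1
      nlinarith [mul_pos (sub_pos.2 hac) hd, mul_pos (sub_pos.2 had) (neg_pos.2 hc)]
  constructor
  · intro hc
    rcases lt_or_gt_of_ne hd0 with hd | hd
    · exact hd
    · exact (key c d hac hcb had hdb h hc hd).elim
  · intro hd
    rcases lt_or_gt_of_ne hc0 with hc | hc
    · exact hc
    · exact (key d c had hdb hac hcb (by rwa [segment_symm ℝ d c]) hd hc).elim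

theorem det_neg_iff_of_interleaved {ε : ℝ} {a b c d : ℝ × ℝ} (hac : lin ε a < lin ε c)
    (hcb : lin ε c < lin ε b) (hbd : lin ε b < lin ε d)
    (h : Disjoint (segment ℝ a b) (segment ℝ c d)) : det a b c < 0 ↔ 0 < det c d b := by
  have hc0 : det a b c ≠ 0 := fun h0 => Set.disjoint_left.1 h
    (mem_segment_of_det_eq_zero hac hcb h0) (left_mem_segment ℝ c d)
  have hb0 : det c d b ≠ 0 := fun h0 => Set.disjoint_left.1 h
    (right_mem_segment ℝ a b) (mem_segment_of_det_eq_zero hcb hbd h0)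
  have e1 := lin_relation ε a b c d
  have e2 := det_relation a b c d
  have eC : (lin ε b - lin ε c) * det a b d =
      -((lin ε b - lin ε a) * det c d b) - (lin ε d - lin ε b) * det a b c := by
    linear_combination (lin ε b) * e2 - e1
  have eB : (lin ε b - lin ε c) * det c d a =
      -((lin ε c - lin ε a) * det c d b) - (lin ε d - lin ε c) * det a b c := by
    linear_combination (lin ε c) * e2 - e1
  have hpos : 0 < lin ε b - lin ε c := by linarith
  constructor
  · intro hc
    by_contra hb
    have hb' : det c d b < 0 := lt_of_le_of_ne (not_lt.1 hb) hb0
    have hd : 0 < det a b d := by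
      refine pos_of_mul_pos_right (a := lin ε b - lin ε c) ?_ hpos.le
      rw [eC]
      nlinarith [mul_pos (show 0 < lin ε b - lin ε a by linarith) (neg_pos.2 hb'),
        mul_pos (sub_pos.2 hbd) (neg_pos.2 hc)]
    have ha : 0 < det c d a := by
      refine pos_of_mul_pos_right (a := lin ε b - lin ε c) ?_ hpos.le
      rw [eB]
      nlinarith [mul_pos (sub_pos.2 hac) (neg_pos.2 hb'),
        mul_pos (show 0 < lin ε d - lin ε c by linarith) (neg_pos.2 hc)]
    exact not_disjoint_of_det hc.le hd.le (hc.trans hd) hb'.le ha.le h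
  · intro hb
    by_contra hc
    have hc' : 0 < det a b c := lt_of_le_of_ne (not_lt.1 hc) hc0.symm
    have hd : det a b d < 0 := by
      refine neg_of_mul_neg_right (a := lin ε b - lin ε c) ?_ hpos.le
      rw [eC]
      nlinarith [mul_pos (show 0 < lin ε b - lin ε a by linarith) hb,
        mul_pos (sub_pos.2 hbd) hc']
    have ha : det c d a < 0 := by
      refine neg_of_mul_neg_right (a := lin ε b - lin ε c) ?_ hpos.le
      rw [eB]
      nlinarith [mul_pos (sub_pos.2 hac) hb,
        mul_pos (show 0 < lin ε d - lin ε c by linarith) hc']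
    refine not_disjoint_of_det (a := a) (b := b) (c := d) (d := c) hd.le hc'.le (hd.trans hc')
      ?_ ?_ (by rwa [segment_symm ℝ d c])
    · rw [det_swap]; linarith
    · rw [det_swap]; linarith

open Classical in
/-- Whether the segment `ab` passes above `p`. -/
noncomputable def above (ε : ℝ) (a b p : ℝ × ℝ) : ZMod 2 :=
  if (lin ε a < lin ε p ∧ lin ε p < lin ε b ∧ det a b p < 0) ∨
    (lin ε b < lin ε p ∧ lin ε p < lin ε a ∧ det b a p < 0) then 1 else 0

open Classical in
/-- Whether the segment `ab` passes below `p`. -/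
noncomputable def below (ε : ℝ) (a b p : ℝ × ℝ) : ZMod 2 :=
  if (lin ε a < lin ε p ∧ lin ε p < lin ε b ∧ 0 < det a b p) ∨
    (lin ε b < lin ε p ∧ lin ε p < lin ε a ∧ 0 < det b a p) then 1 else 0

open Classical in
/-- Whether `p` is to the left of `q`. -/
noncomputable def left (ε : ℝ) (p q : ℝ × ℝ) : ZMod 2 := if lin ε p < lin ε q then 1 else 0

theorem above_swap (ε : ℝ) (a b p : ℝ × ℝ) : above ε b a p = above ε a b p := by
  unfold above; congr 1; rw [or_comm]

theorem below_swap (ε : ℝ) (a b p : ℝ × ℝ) : below ε b a p = below ε a b p := by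
  unfold below; congr 1; rw [or_comm]

theorem left_add_left {ε : ℝ} {p q : ℝ × ℝ} (h : lin ε p ≠ lin ε q) :
    left ε p q + left ε q p = 1 := by
  unfold left
  rcases lt_or_gt_of_ne h with h | h <;> simp [h, h.not_gt]

theorem above_add_below {ε : ℝ} {a b p : ℝ × ℝ} (ha : lin ε p ≠ lin ε a) (hb : lin ε p ≠ lin ε b)
    (h : p ∉ segment ℝ a b) :
    above ε a b p + below ε a b p = left ε p a + left ε p b := by
  unfold above below left
  have h11 : (1 : ZMod 2) + 1 = 0 := by decide
  rcases lt_or_gt_of_ne ha with ha | ha <;> rcases lt_or_gt_of_ne hb with hb | hb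
  · simp [ha, hb, ha.not_gt, hb.not_gt, h11]
  · have h0 : det b a p ≠ 0 := fun h0 => h (by
      rw [segment_symm]; exact mem_segment_of_det_eq_zero hb ha h0)
    rcases lt_or_gt_of_ne h0 with h0 | h0 <;> simp [ha, hb, ha.not_gt, hb.not_gt, h0, h0.not_gt]
  · have h0 : det a b p ≠ 0 := fun h0 => h (mem_segment_of_det_eq_zero ha hb h0)
    rcases lt_or_gt_of_ne h0 with h0 | h0 <;> simp [ha, hb, ha.not_gt, hb.not_gt, h0, h0.not_gt]
  · simp [ha, hb, ha.not_gt, hb.not_gt]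

open Classical in
theorem above_of_lt {ε : ℝ} {a b p : ℝ × ℝ} (hab : lin ε a < lin ε b) :
    above ε a b p = if lin ε a < lin ε p ∧ lin ε p < lin ε b ∧ det a b p < 0 then 1 else 0 := by
  unfold above
  refine if_congr ⟨fun h => h.resolve_right fun h => ?_, Or.inl⟩ rfl rfl
  linarith [h.1, h.2.1]

open Classical in
theorem below_of_lt {ε : ℝ} {a b p : ℝ × ℝ} (hab : lin ε a < lin ε b) :
    below ε a b p = if lin ε a < lin ε p ∧ lin ε p < lin ε b ∧ 0 < det a b p then 1 else 0 := by
  unfold below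
  refine if_congr ⟨fun h => h.resolve_right fun h => ?_, Or.inl⟩ rfl rfl
  linarith [h.1, h.2.1]

/-- If the ranges of the two segments under `lin ε` overlap, one segment is above the other
throughout the overlap. The two ends of the overlap are endpoints of segments, and each contributes
1 exactly when `ab` is the upper one. So the sum is 0 or 2. -/
theorem link_of_lt {ε : ℝ} {a b c d : ℝ × ℝ} (hab : lin ε a < lin ε b) (hcd : lin ε c < lin ε d)
    (hac : lin ε a ≠ lin ε c) (had : lin ε a ≠ lin ε d) (hbc : lin ε b ≠ lin ε c)
    (hbd : lin ε b ≠ lin ε d) (h : Disjoint (segment ℝ a b) (segment ℝ c d)) :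
    above ε a b c + above ε a b d + below ε c d a + below ε c d b = 0 := by
  classical
  have h11 : (1 : ZMod 2) + 1 = 0 := by decide
  rw [above_of_lt hab, above_of_lt hab, below_of_lt hcd, below_of_lt hcd]
  rcases lt_or_gt_of_ne hac with hac | hac
  · rcases lt_or_gt_of_ne hbc with hbc | hbc
    · have had := hac.trans hcd
      have hbd := hbc.trans hcd
      simp [hac.not_gt, hbc.not_gt, hbd.not_gt]
    · rcases lt_or_gt_of_ne hbd with hbd | hbd
      · have key := det_neg_iff_of_interleaved hac hbc hbd h
        by_cases h0 : det a b c < 0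
        · simp [hac, hac.not_gt, hbc, hbd, hbd.not_gt, h0, key.1 h0, h11]
        · have h1 := mt key.2 h0
          simp [hac.not_gt, hbd.not_gt, h0, h1]
      · have had := hac.trans hcd
        have key := det_neg_iff_of_nested hac hbc had hbd h
        by_cases h0 : det a b c < 0
        · simp [hac, hac.not_gt, had, hbc, hbd, hbd.not_gt, h0, key.1 h0, h11]
        · have h1 := mt key.2 h0
          simp [hac.not_gt, hbd.not_gt, h0, h1]
  · have hbc : lin ε c < lin ε b := hac.trans hab
    rcases lt_or_gt_of_ne had with had | had
    · rcases lt_or_gt_of_ne hbd with hbd | hbd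
      · have key : 0 < det c d a ↔ 0 < det c d b := by
          have h1 : det c d a ≠ 0 := fun h0 => Set.disjoint_left.1 h
            (left_mem_segment ℝ a b) (mem_segment_of_det_eq_zero hac had h0)
          have h2 : det c d b ≠ 0 := fun h0 => Set.disjoint_left.1 h
            (right_mem_segment ℝ a b) (mem_segment_of_det_eq_zero hbc hbd h0)
          have h3 := det_neg_iff_of_nested hac had hbc hbd h.symm
          constructor
          · intro h4
            exact lt_of_le_of_ne (not_lt.1 fun h5 => (h3.2 h5).not_gt h4) h2.symm
          · intro h4
            exact lt_of_le_of_ne (not_lt.1 fun h5 => (h3.1 h5).not_gt h4) h1.symm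
        by_cases h0 : 0 < det c d a
        · simp [hac, hac.not_gt, had, hbc, hbd, hbd.not_gt, h0, key.1 h0, h11]
        · have h1 := mt key.2 h0
          simp [hac.not_gt, hbd.not_gt, h0, h1]
      · have key := det_neg_iff_of_interleaved hac had hbd h.symm
        have h1 : det c d a ≠ 0 := fun h0 => Set.disjoint_left.1 h
            (left_mem_segment ℝ a b) (mem_segment_of_det_eq_zero hac had h0)
        have h2 : det a b d ≠ 0 := fun h0 => Set.disjoint_left.1 h
            (mem_segment_of_det_eq_zero had hbd h0) (right_mem_segment ℝ c d)
        by_cases h0 : det c d a < 0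
        · have h3 := key.1 h0
          simp [hac.not_gt, hbd.not_gt, h0.not_gt, h3.not_gt]
        · have h3 : 0 < det c d a := lt_of_le_of_ne (not_lt.1 h0) h1.symm
          have h4 : det a b d < 0 := lt_of_le_of_ne (not_lt.1 fun h => h0 (key.2 h)) h2
          simp [hac, hac.not_gt, had, hbd, hbd.not_gt, h3, h4, h11]
    · have hbd := had.trans hab
      simp [hac.not_gt, had.not_gt, hbd.not_gt]

theorem link {ε : ℝ} {a b c d : ℝ × ℝ} (hab : lin ε a ≠ lin ε b) (hcd : lin ε c ≠ lin ε d)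
    (hac : lin ε a ≠ lin ε c) (had : lin ε a ≠ lin ε d) (hbc : lin ε b ≠ lin ε c)
    (hbd : lin ε b ≠ lin ε d) (h : Disjoint (segment ℝ a b) (segment ℝ c d)) :
    above ε a b c + above ε a b d + below ε c d a + below ε c d b = 0 := by
  rcases lt_or_gt_of_ne hab with hab | hab <;> rcases lt_or_gt_of_ne hcd with hcd | hcd
  · exact link_of_lt hab hcd hac had hbc hbd h
  · rw [segment_symm ℝ c d] at h
    have := link_of_lt hab hcd had hac hbd hbc h
    rw [below_swap ε c d, below_swap ε c d] at this
    rw [← this]; ring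
  · rw [segment_symm ℝ a b] at h
    have := link_of_lt hab hcd hbc hbd hac had h
    rw [above_swap ε a b, above_swap ε a b] at this
    rw [← this]; ring
  · rw [segment_symm ℝ a b, segment_symm ℝ c d] at h
    have := link_of_lt hab hcd hbd hbc had hac h
    rw [above_swap ε a b, above_swap ε a b, below_swap ε c d, below_swap ε c d] at this
    rw [← this]; ring

end PlaneSegment

/-! ### From segments to polylines. -/

theorem Fin.sum_castSucc_add_succ {n : ℕ} (g : Fin (n + 2) → ZMod 2) :
    ∑ i : Fin (n + 1), (g i.castSucc + g i.succ) = g 0 + g (Fin.last (n + 1)) := by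
  have h1 := Fin.sum_univ_castSucc g
  have h2 := Fin.sum_univ_succ g
  rw [Finset.sum_add_distrib]
  grind

namespace PolylineDrawing

open PlaneSegment

variable {V : Type*} {G : SimpleGraph V} (D : PolylineDrawing G)

/-- The number of segments of `e` above `p`, modulo 2. -/
noncomputable def edgeAbove (ε : ℝ) (e : G.edgeSet) (p : ℝ × ℝ) : ZMod 2 :=
  ∑ i : Fin (D.numBends e + 1), above ε (D.pt e i.castSucc) (D.pt e i.succ) p

/-- The number of segments of `e` below `p`, modulo 2. -/
noncomputable def edgeBelow (ε : ℝ) (e : G.edgeSet) (p : ℝ × ℝ) : ZMod 2 :=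
  ∑ i : Fin (D.numBends e + 1), below ε (D.pt e i.castSucc) (D.pt e i.succ) p

/-- The vertices and the bends of a drawing. -/
def corners : Set (ℝ × ℝ) :=
  Set.range D.pos ∪ Set.range fun q : Σ e : G.edgeSet, Fin (D.numBends e + 2) => D.pt q.1 q.2

theorem finite_corners [Finite V] : D.corners.Finite :=
  (Set.finite_range _).union (Set.finite_range _)

theorem pos_mem_corners (v : V) : D.pos v ∈ D.corners := Or.inl ⟨v, rfl⟩

theorem pt_mem_corners (e : G.edgeSet) (i : Fin (D.numBends e + 2)) : D.pt e i ∈ D.corners :=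
  Or.inr ⟨⟨e, i⟩, rfl⟩

theorem add_endpoints {a b : V} (h : s(a, b) ∈ G.edgeSet) (g : ℝ × ℝ → ZMod 2) :
    g (D.pos a) + g (D.pos b) = g (D.pt ⟨s(a, b), h⟩ 0) + g (D.pt ⟨s(a, b), h⟩ (Fin.last _)) := by
  rw [D.pt_zero, D.pt_last]
  rcases Sym2.eq_iff.1 (D.edge_eq ⟨s(a, b), h⟩) with ⟨h1, h2⟩ | ⟨h1, h2⟩
  · rw [← h1, ← h2]
  · rw [← h1, ← h2, add_comm]

theorem lin_ne_of_notMem_segment {ε : ℝ} (hε : Set.InjOn (lin ε) D.corners) {e : G.edgeSet}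
    {i : Fin (D.numBends e + 1)} {p : ℝ × ℝ} (hp : p ∈ D.corners)
    (h : p ∉ segment ℝ (D.pt e i.castSucc) (D.pt e i.succ)) :
    lin ε p ≠ lin ε (D.pt e i.castSucc) ∧ lin ε p ≠ lin ε (D.pt e i.succ) := by
  constructor
  · intro h1
    rw [hε hp (D.pt_mem_corners _ _) h1] at h
    exact h (left_mem_segment _ _ _)
  · intro h1
    rw [hε hp (D.pt_mem_corners _ _) h1] at h
    exact h (right_mem_segment _ _ _)

theorem edgeAbove_add_edgeBelow {ε : ℝ} (hε : Set.InjOn (lin ε) D.corners) {a b p : V}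
    (h : s(a, b) ∈ G.edgeSet) (hpa : p ≠ a) (hpb : p ≠ b) :
    D.edgeAbove ε ⟨s(a, b), h⟩ (D.pos p) + D.edgeBelow ε ⟨s(a, b), h⟩ (D.pos p) =
      left ε (D.pos p) (D.pos a) + left ε (D.pos p) (D.pos b) := by
  rw [D.add_endpoints h (left ε (D.pos p)), edgeAbove, edgeBelow, ← Finset.sum_add_distrib,
    ← Fin.sum_castSucc_add_succ fun i => left ε (D.pos p) (D.pt ⟨s(a, b), h⟩ i)]
  refine Finset.sum_congr rfl fun i _ => ?_
  have hp : D.pos p ∉ segment ℝ (D.pt ⟨s(a, b), h⟩ i.castSucc) (D.pt ⟨s(a, b), h⟩ i.succ) := by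
    intro h1
    rcases Sym2.mem_iff.1 (D.vertex_mem _ _ _ h1) with h2 | h2
    · exact hpa h2
    · exact hpb h2
  obtain ⟨h1, h2⟩ := D.lin_ne_of_notMem_segment hε (D.pos_mem_corners p) hp
  exact above_add_below h1 h2 hp

/-- Modulo 2, a sum over the two ends of a polyline equals the sum over both ends of all its
segments. This turns the claim into a double sum of `link` over pairs of segments. -/
theorem edgeAbove_link {ε : ℝ} (hε : Set.InjOn (lin ε) D.corners) {a b x y : V}
    (h : s(a, b) ∈ G.edgeSet) (h' : s(x, y) ∈ G.edgeSet)
    (hd : ∀ i j, Disjoint (segment ℝ (D.pt ⟨s(a, b), h⟩ (Fin.castSucc i)) (D.pt ⟨s(a, b), h⟩ i.succ))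
      (segment ℝ (D.pt ⟨s(x, y), h'⟩ (Fin.castSucc j)) (D.pt ⟨s(x, y), h'⟩ j.succ))) :
    D.edgeAbove ε ⟨s(a, b), h⟩ (D.pos x) + D.edgeAbove ε ⟨s(a, b), h⟩ (D.pos y) +
      D.edgeBelow ε ⟨s(x, y), h'⟩ (D.pos a) + D.edgeBelow ε ⟨s(x, y), h'⟩ (D.pos b) = 0 := by
  rw [add_assoc, D.add_endpoints h' (D.edgeAbove ε ⟨s(a, b), h⟩),
    D.add_endpoints h (D.edgeBelow ε ⟨s(x, y), h'⟩),
    ← Fin.sum_castSucc_add_succ fun i => D.edgeAbove ε ⟨s(a, b), h⟩ (D.pt ⟨s(x, y), h'⟩ i),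
    ← Fin.sum_castSucc_add_succ fun i => D.edgeBelow ε ⟨s(x, y), h'⟩ (D.pt ⟨s(a, b), h⟩ i)]
  simp only [edgeAbove, edgeBelow, ← Finset.sum_add_distrib]
  rw [Finset.sum_comm, ← Finset.sum_add_distrib]
  refine Finset.sum_eq_zero fun i _ => ?_
  rw [← Finset.sum_add_distrib]
  refine Finset.sum_eq_zero fun j _ => ?_
  have hne : ∀ e k, lin ε (D.pt e (Fin.castSucc k)) ≠ lin ε (D.pt e k.succ) := fun e k hk =>
    D.pt_ne e k (hε (D.pt_mem_corners _ _) (D.pt_mem_corners _ _) hk)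
  have hdis := hd i j
  rw [Set.disjoint_left] at hdis
  obtain ⟨h1, h2⟩ := D.lin_ne_of_notMem_segment hε (D.pt_mem_corners _ _)
    (hdis (left_mem_segment _ _ _))
  obtain ⟨h3, h4⟩ := D.lin_ne_of_notMem_segment hε (D.pt_mem_corners _ _)
    (hdis (right_mem_segment _ _ _))
  rw [← add_assoc]
  exact link (hne _ _) (hne _ _) h1 h2 h3 h4 (hd i j)

theorem exists_crossingParity [Finite V] {H : SimpleGraph V} (hH : H ≤ G)
    (hcr : ∀ e f : G.edgeSet, (e : Sym2 V) ∈ H.edgeSet → (f : Sym2 V) ∈ H.edgeSet →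
      ∀ i j, ¬ D.Crosses e f i j) : ∃ r s c, CrossingParity H r s c := by
  classical
  obtain ⟨ε, hε⟩ := exists_lin_injOn D.corners D.finite_corners
  refine ⟨fun a b p => if h : s(a, b) ∈ G.edgeSet then D.edgeAbove ε ⟨s(a, b), h⟩ (D.pos p) else 0,
    fun a b p => if h : s(a, b) ∈ G.edgeSet then D.edgeBelow ε ⟨s(a, b), h⟩ (D.pos p) else 0,
    fun p q => left ε (D.pos p) (D.pos q), ?_, ?_, ?_⟩
  · intro a b p hab hpa hpb
    have h : s(a, b) ∈ G.edgeSet := hH hab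
    simp only [h, dif_pos]
    exact D.edgeAbove_add_edgeBelow hε h hpa hpb
  · intro a b x y hab hxy hax hay hbx hby
    have h : s(a, b) ∈ G.edgeSet := hH hab
    have h' : s(x, y) ∈ G.edgeSet := hH hxy
    simp only [h, h', dif_pos]
    have hnot : ∀ v, v ∈ s(a, b) → v ∈ s(x, y) → False := by
      intro v hv hv'
      rcases Sym2.mem_iff.1 hv with rfl | rfl <;> rcases Sym2.mem_iff.1 hv' with rfl | rfl <;>
        contradiction
    have hne : (⟨s(a, b), h⟩ : G.edgeSet) ≠ ⟨s(x, y), h'⟩ := by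
      intro heq
      have : s(a, b) = s(x, y) := congrArg Subtype.val heq
      exact hnot a (by simp) (by rw [← this]; simp)
    refine D.edgeAbove_link hε h h' fun i j => Set.disjoint_left.2 fun p hp hp' => ?_
    rcases D.inter _ _ hne i j p hp hp' with ⟨v, hv, hv', -⟩ | ⟨h1, h2, -⟩
    · exact hnot v hv hv'
    · exact hcr ⟨s(a, b), h⟩ ⟨s(x, y), h'⟩ hab hxy i j ⟨hne, p, h1, h2⟩
  · intro p q hpq
    exact left_add_left fun h =>
      hpq (D.pos_injective (hε (D.pos_mem_corners _) (D.pos_mem_corners _) h))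

theorem ncard_edgeSet_add_six_le_of_not_crosses [Fintype V] {H : SimpleGraph V} (hH : H ≤ G)
    (hcr : ∀ e f : G.edgeSet, (e : Sym2 V) ∈ H.edgeSet → (f : Sym2 V) ∈ H.edgeSet →
      ∀ i j, ¬ D.Crosses e f i j) (hV : 3 ≤ Fintype.card V) :
    H.edgeSet.ncard + 6 ≤ 3 * Fintype.card V := by
  classical
  obtain ⟨r, s, c, h⟩ := D.exists_crossingParity hH hcr
  have := CrossingParity.card_edgeFinset_add_six_le (Fintype.card V - 3) Finset.univ H r s h
    (by rw [Finset.card_univ]; omega) (by simp)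
  rw [← SimpleGraph.coe_edgeFinset, Set.ncard_coe_finset]
  omega

/-! ### Edges with a crossed vertical segment, and the upper bound. -/

/-- The edges that have a vertical segment involved in a crossing. -/
def verticallyCrossed : Set (Sym2 V) :=
  {e | ∃ (h : e ∈ G.edgeSet) (f : G.edgeSet) (i : _) (j : _), D.Crosses ⟨e, h⟩ f i j ∧
    (D.pt ⟨e, h⟩ i.castSucc).1 = (D.pt ⟨e, h⟩ i.succ).1}

/-- In a drawing with at most one bend per edge, every segment ends at a vertex. -/
theorem exists_segment_eq_pos (hD : D.IsBend 1) (e : G.edgeSet) (i : Fin (D.numBends e + 1)) :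
    ∃ v ∈ (e : Sym2 V), (D.pt e i.castSucc = D.pos v ∨ D.pt e i.succ = D.pos v) := by
  have h := hD e
  have hi := i.2
  by_cases h0 : (i : ℕ) = 0
  · refine ⟨D.src e, by rw [D.edge_eq]; simp, Or.inl ?_⟩
    rw [← D.pt_zero]
    congr 1
    exact Fin.ext h0
  · refine ⟨D.tgt e, by rw [D.edge_eq]; simp, Or.inr ?_⟩
    rw [← D.pt_last]
    congr 1
    refine Fin.ext ?_
    simp only [Fin.val_succ, Fin.val_last]
    omega

theorem verticallyCrossed_subset : D.verticallyCrossed ⊆ G.edgeSet := fun _ h => h.1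

/-- A crossed vertical segment, seen from an end of it that is a vertex. -/
theorem exists_vertical_port (hD : D.IsBend 1) (hR : D.IsRAC) {e : Sym2 V}
    (he : e ∈ D.verticallyCrossed) :
    ∃ (v w : V) (q : ℝ × ℝ), v ∈ e ∧ q.1 = (D.pos v).1 ∧
      (((D.pos v).2 < (D.pos w).2 ∧ (D.pos w).2 < q.2) ∨
        (q.2 < (D.pos w).2 ∧ (D.pos w).2 < (D.pos v).2)) ∧
      ∃ (h : e ∈ G.edgeSet) (i : Fin (D.numBends ⟨e, h⟩ + 1)),
        segment ℝ (D.pt ⟨e, h⟩ i.castSucc) (D.pt ⟨e, h⟩ i.succ) = segment ℝ (D.pos v) q ∧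
        (D.pt ⟨e, h⟩ i.castSucc).1 = (D.pt ⟨e, h⟩ i.succ).1 := by
  obtain ⟨h, f, i, j, hcr, hx⟩ := he
  obtain ⟨v, hv, hvi⟩ := D.exists_segment_eq_pos hD ⟨e, h⟩ i
  obtain ⟨w, -, hwj⟩ := D.exists_segment_eq_pos hD f j
  have hrac := hR _ _ _ _ hcr
  have hpt := D.pt_ne ⟨e, h⟩ i
  obtain ⟨-, p, hp, hp'⟩ := hcr
  have hy : (D.pt ⟨e, h⟩ i.castSucc).2 ≠ (D.pt ⟨e, h⟩ i.succ).2 := fun hy => hpt (Prod.ext hx hy)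
  have hf : (D.pt f j.castSucc).2 = (D.pt f j.succ).2 := by
    rw [hx, sub_self, zero_mul, zero_add] at hrac
    rcases mul_eq_zero.1 hrac with h1 | h1
    · exact absurd (sub_eq_zero.1 h1).symm hy
    · exact (sub_eq_zero.1 h1).symm
  -- The crossing segment of `f` is horizontal and ends at `w`, so the crossing point `p` has the
  -- height of `w`.
  have hw : (D.pos w).2 = p.2 := by
    obtain ⟨s, t, hs, ht, hst, rfl⟩ := hp'
    simp only [Prod.snd_add, Prod.smul_snd, smul_eq_mul]
    rcases hwj with h1 | h1
    · rw [← h1, ← hf, ← add_mul, hst, one_mul]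
    · rw [← h1, hf, ← add_mul, hst, one_mul]
  have hbetween : ∀ a b : ℝ × ℝ, a.2 ≠ b.2 → p ∈ openSegment ℝ a b →
      (a.2 < p.2 ∧ p.2 < b.2) ∨ (b.2 < p.2 ∧ p.2 < a.2) := by
    rintro a b hab ⟨s, t, hs, ht, hst, rfl⟩
    simp only [Prod.snd_add, Prod.smul_snd, smul_eq_mul]
    obtain rfl : s = 1 - t := by linarith
    rcases lt_or_gt_of_ne hab with h1 | h1
    · left; constructor <;> nlinarith [mul_pos hs (sub_pos.2 h1), mul_pos ht (sub_pos.2 h1)]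
    · right; constructor <;> nlinarith [mul_pos hs (sub_pos.2 h1), mul_pos ht (sub_pos.2 h1)]
  rcases hvi with h1 | h1
  · refine ⟨v, w, D.pt ⟨e, h⟩ i.succ, hv, by rw [← hx, h1], ?_, h, i, by rw [h1], hx⟩
    rw [hw, ← h1]
    exact hbetween _ _ hy hp
  · refine ⟨v, w, D.pt ⟨e, h⟩ i.castSucc, hv, by rw [hx, h1], ?_, h, i, by rw [h1, segment_symm], hx⟩
    rw [hw, ← h1]
    rw [openSegment_symm] at hp
    exact hbetween _ _ hy.symm hp

theorem vertical_segments_meet {v q q' : ℝ × ℝ} (h1 : q.1 = v.1) (h2 : q'.1 = v.1)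
    (h : v.2 < q.2 ∧ v.2 < q'.2 ∨ q.2 < v.2 ∧ q'.2 < v.2) :
    ∃ x, x ≠ v ∧ x ∈ segment ℝ v q ∧ x ∈ segment ℝ v q' := by
  have key : ∀ q q' : ℝ × ℝ, q.1 = v.1 → q'.1 = v.1 →
      (v.2 < q'.2 ∧ q'.2 ≤ q.2 ∨ q'.2 < v.2 ∧ q.2 ≤ q'.2) →
      q' ∈ segment ℝ v q := by
    intro q q' h1 h2 h
    have h3 : q.2 - v.2 ≠ 0 := by rcases h with h | h <;> intro h0 <;> linarith
    refine ⟨(q.2 - q'.2) / (q.2 - v.2), (q'.2 - v.2) / (q.2 - v.2), ?_, ?_, by field_simp; ring, ?_⟩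
    · rcases h with h | h
      · exact div_nonneg (by linarith) (by linarith)
      · exact div_nonneg_of_nonpos (by linarith) (by linarith)
    · rcases h with h | h
      · exact div_nonneg (by linarith) (by linarith)
      · exact div_nonneg_of_nonpos (by linarith) (by linarith)
    · ext
      · simp only [Prod.fst_add, Prod.smul_fst, smul_eq_mul, h1, h2]
        field_simp
        ring
      · simp only [Prod.snd_add, Prod.smul_snd, smul_eq_mul]
        field_simp
        ring
  have ne : ∀ q : ℝ × ℝ, q.2 ≠ v.2 → q ≠ v := fun q hq h => hq (by rw [h])
  rcases le_total q.2 q'.2 with h3 | h3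
  · rcases h with h | h
    · exact ⟨q, ne _ h.1.ne', right_mem_segment _ _ _, key q' q h2 h1 (Or.inl ⟨h.1, h3⟩)⟩
    · exact ⟨q', ne _ h.2.ne, key q q' h1 h2 (Or.inr ⟨h.2, h3⟩), right_mem_segment _ _ _⟩
  · rcases h with h | h
    · exact ⟨q', ne _ h.2.ne', key q q' h1 h2 (Or.inl ⟨h.2, h3⟩), right_mem_segment _ _ _⟩
    · exact ⟨q, ne _ h.1.ne, right_mem_segment _ _ _, key q' q h2 h1 (Or.inr ⟨h.1, h3⟩)⟩

/-- Edges inject into ports: `(v, true)` is the upward port of `v` and `(v, false)` the downward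
one. Two edges at one port would overlap in a point other than `v`. -/
theorem ncard_verticallyCrossed_le [Fintype V] [Nonempty V] (hD : D.IsBend 1) (hR : D.IsRAC) :
    D.verticallyCrossed.ncard + 2 ≤ 2 * Fintype.card V := by
  classical
  obtain ⟨t, ht⟩ := Finite.exists_max fun v => (D.pos v).2
  obtain ⟨b, hb⟩ := Finite.exists_min fun v => (D.pos v).2
  choose! v w q hv hq hw hseg using
    fun e (he : e ∈ D.verticallyCrossed) => D.exists_vertical_port hD hR he
  -- A highest vertex `t` has no vertex `w` above it to carry a crossing, and a lowest vertex `b`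
  -- none below.
  let P : Finset (V × Bool) := (Finset.univ.erase (t, true)).erase (b, false)
  have hP : P.card + 2 = 2 * Fintype.card V := by
    have h1 : P.card + 1 = (Finset.univ.erase (t, true)).card :=
      Finset.card_erase_add_one (by simp)
    have h2 : (Finset.univ.erase (t, true)).card + 1 = (Finset.univ : Finset (V × Bool)).card :=
      Finset.card_erase_add_one (by simp)
    rw [Finset.card_univ, Fintype.card_prod, Fintype.card_bool] at h2
    omega
  have hle : D.verticallyCrossed.ncard ≤ (P : Set (V × Bool)).ncard := by
    refine Set.ncard_le_ncard_of_injOn (fun e => (v e, decide ((D.pos (v e)).2 < (q e).2))) ?_ ?_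
      P.finite_toSet
    · intro e he
      have h1 := hw e he
      have h2 := ht (w e)
      have h3 := hb (w e)
      simp only [P, Finset.coe_erase, Finset.coe_univ, Set.mem_sdiff, Set.mem_univ, true_and,
        Set.mem_singleton_iff, Prod.mk.injEq, not_and, decide_eq_true_eq, decide_eq_false_iff_not]
      constructor
      · rintro rfl h4
        rcases h1 with h1 | h1
        · linarith
        · linarith
      · rintro rfl h4
        rcases h1 with h1 | h1
        · linarith
        · exact h4 (by linarith)
    · intro e he f hf hef
      simp only [Prod.mk.injEq, decide_eq_decide] at hef
      obtain ⟨hvf, hup⟩ := hef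
      by_contra hne
      obtain ⟨x, hxv, hxe, hxf⟩ := 
        vertical_segments_meet (v := D.pos (v e)) (q' := q f) (hq e he) (by rw [hvf]; exact hq f hf) (by
        have h1 := hw e he
        have h2 := hw f hf
        rw [← hvf] at h2 hup
        by_cases h3 : (D.pos (v e)).2 < (q e).2
        · exact Or.inl ⟨h3, hup.1 h3⟩
        · have h4 := mt hup.2 h3
          refine Or.inr ⟨?_, ?_⟩
          · rcases h1 with h1 | h1 <;> linarith
          · rcases h2 with h2 | h2 <;> linarith)
      obtain ⟨ge, i, hse, hxe'⟩ := hseg e he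
      obtain ⟨gf, j, hsf, hxf'⟩ := hseg f hf
      rw [← hse] at hxe
      rw [hvf, ← hsf] at hxf
      rcases D.inter ⟨e, ge⟩ ⟨f, gf⟩ (fun h => hne (congrArg Subtype.val h)) _ _ x hxe hxf
        with ⟨u, hue, huf, rfl⟩ | ⟨-, -, h⟩
      -- Edges sharing both `v e` and a second vertex `u` are equal, since the graph is simple.
      · have huv : v e ≠ u := fun h => hxv (by rw [h])
        refine hne (((Sym2.mem_and_mem_iff huv).1 ⟨hv e he, hue⟩).trans
          ((Sym2.mem_and_mem_iff huv).1 ⟨?_, huf⟩).symm)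
        rw [hvf]
        exact hv f hf
      · refine h ?_
        rw [hxe', hxf']
        ring
  rw [Set.ncard_coe_finset] at hle
  omega

theorem ncard_edgeSet_le [Fintype V] (hD : D.IsBend 1) (hA : D.IsApRAC)
    (hV : 2 ≤ Fintype.card V) : G.edgeSet.ncard + 8 ≤ 5 * Fintype.card V := by
  classical
  -- The planar bound fails for two vertices, but then there is at most one edge.
  rcases hV.eq_or_lt with h2 | h3
  · have h1 := G.card_edgeFinset_le_card_choose_two
    rw [← h2, Nat.choose_self] at h1
    rw [← SimpleGraph.coe_edgeFinset, Set.ncard_coe_finset]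
    omega
  have : Nonempty V := Fintype.card_pos_iff.1 (by omega)
  have hvert := D.ncard_verticallyCrossed_le hD hA.1
  set H := G.deleteEdges D.verticallyCrossed with hH
  have hHe : H.edgeSet = G.edgeSet \ D.verticallyCrossed := G.edgeSet_deleteEdges _
  have hplan := D.ncard_edgeSet_add_six_le_of_not_crosses (H := H) (G.deleteEdges_le _) (by
    intro e f he hf i j hcr
    rw [hHe] at he hf
    obtain ⟨he', hf'⟩ := hA.2 _ _ _ _ hcr
    rcases he' with he' | he'
    · rcases hf' with hf' | hf'
      · have h1 := hA.1 _ _ _ _ hcr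
        rw [he', sub_self, zero_mul, add_zero] at h1
        rcases mul_eq_zero.1 h1 with h1 | h1
        · exact D.pt_ne e i (Prod.ext (sub_eq_zero.1 h1).symm he')
        · exact D.pt_ne f j (Prod.ext (sub_eq_zero.1 h1).symm hf')
      · refine hf.2 ⟨f.2, e, j, i, ⟨hcr.1.symm, ?_⟩, hf'⟩
        rw [Set.inter_comm]
        exact hcr.2
    · exact he.2 ⟨e.2, f, i, j, hcr, he'⟩) h3
  have h4 := Set.ncard_sdiff_add_ncard_of_subset D.verticallyCrossed_subset (Set.toFinite _)
  rw [← hHe] at h4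
  omega

end PolylineDrawing

/-! ### The extremal family: vertices, edges and coordinates. -/

namespace FourPoles

/-- The edges of the drawing: a path of `k + 1` vertices on the diagonal, four edges from each of
them to the poles, and five edges between the poles. -/
inductive Arc (k : ℕ)
  | path (i : Fin k)
  | left (i : Fin (k + 1))
  | right (i : Fin (k + 1))
  | up (i : Fin (k + 1))
  | down (i : Fin (k + 1))
  | wn
  | ne
  | se
  | ws
  | we

/-- The vertices: the path and the poles west, north, east and south. -/
inductive Vert (k : ℕ)
  | diag (i : Fin (k + 1))
  | west
  | north
  | east
  | south

variable {k : ℕ}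

namespace Vert

/-- The first coordinate of a vertex. -/
noncomputable def X : Vert k → ℝ
  | diag i => (i : ℕ) + 1
  | west => -1
  | north => 0
  | east => k + 3
  | south => 0

/-- The second coordinate of a vertex. -/
noncomputable def Y : Vert k → ℝ
  | diag i => (i : ℕ) + 1
  | west => k + 5
  | north => k + 3
  | east => 0
  | south => -1

/-- The vertices are the path vertices and four more. -/
def equivSum : Vert k ≃ Fin (k + 1) ⊕ Fin 4 where
  toFun
    | diag i => .inl i
    | west => .inr 0
    | north => .inr 1
    | east => .inr 2
    | south => .inr 3
  invFun
    | .inl i => diag i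
    | .inr 0 => west
    | .inr 1 => north
    | .inr 2 => east
    | .inr 3 => south
  left_inv v := by cases v <;> rfl
  right_inv v := by
    rcases v with i | j
    · rfl
    · fin_cases j <;> rfl

end Vert

namespace Arc

open Vert

/-- The ends of an edge. -/
def fin : Arc k → Bool → Vert k
  | path i, false => diag i.castSucc
  | path i, true => diag i.succ
  | left i, false => diag i
  | left _, true => west
  | right i, false => diag i
  | right _, true => east
  | up i, false => diag i
  | up _, true => north
  | down i, false => diag i
  | down _, true => south
  | wn, false => west
  | wn, true => north
  | ne, false => north
  | ne, true => east
  | se, false => south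
  | se, true => east
  | ws, false => west
  | ws, true => south
  | we, false => west
  | we, true => east

/-- The first coordinate of the bend of an edge. -/
noncomputable def X : Arc k → ℝ
  -- The bends of `path i` and `wn` are midpoints of straight edges, so that all edges uniformly
  -- have one bend.
  | path i => (i : ℕ) + 3 / 2
  | left _ => 0
  | right _ => k + 2
  | up i => (i : ℕ) + 1
  | down i => (i : ℕ) + 1
  | wn => -1 / 2
  | ne => 2 * k + 6
  | se => 2 * k + 7
  | ws => -k - 8
  | we => 3 * k + 12

/-- The second coordinate of the bend of an edge. -/
noncomputable def Y : Arc k → ℝ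
  | path i => (i : ℕ) + 3 / 2
  | left i => (i : ℕ) + 1
  | right i => (i : ℕ) + 1
  | up _ => k + 2
  | down _ => 0
  | wn => k + 4
  | ne => 3 * k + 9
  | se => -2 * k - 8
  | ws => -k - 9
  | we => 4 * k + 18

/-- The two families of edges with an index, and the five others. -/
def equivSum : Arc k ≃ Fin k ⊕ (Fin (k + 1) × Fin 4 ⊕ Fin 5) where
  toFun
    | path i => .inl i
    | left i => .inr (.inl (i, 0))
    | right i => .inr (.inl (i, 1))
    | up i => .inr (.inl (i, 2))
    | down i => .inr (.inl (i, 3))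
    | wn => .inr (.inr 0)
    | ne => .inr (.inr 1)
    | se => .inr (.inr 2)
    | ws => .inr (.inr 3)
    | we => .inr (.inr 4)
  invFun
    | .inl i => path i
    | .inr (.inl (i, 0)) => left i
    | .inr (.inl (i, 1)) => right i
    | .inr (.inl (i, 2)) => up i
    | .inr (.inl (i, 3)) => down i
    | .inr (.inr 0) => wn
    | .inr (.inr 1) => ne
    | .inr (.inr 2) => se
    | .inr (.inr 3) => ws
    | .inr (.inr 4) => we
  left_inv a := by cases a <;> rfl
  right_inv a := by
    rcases a with i | ⟨i, j⟩ | j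
    · rfl
    · fin_cases j <;> rfl
    · fin_cases j <;> rfl

/-- Equations and inequalities for the points of the two segments of an edge. -/
def Region : Arc k → Bool → ℝ → ℝ → Prop
  | path i, false, x, y => y = x ∧ (i : ℕ) + 1 ≤ x ∧ x ≤ (i : ℕ) + 3 / 2
  | path i, true, x, y => y = x ∧ (i : ℕ) + 3 / 2 ≤ x ∧ x ≤ (i : ℕ) + 2
  | left i, false, x, y => y = (i : ℕ) + 1 ∧ 0 ≤ x ∧ x ≤ (i : ℕ) + 1
  -- The equations of the slanted segments contain products. The inequalities on the other
  -- coordinate follow from them, but let linear arithmetic separate these segments from others.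
  | left i, true, x, y => -1 ≤ x ∧ x ≤ 0 ∧ (i : ℕ) + 1 ≤ y ∧ y ≤ k + 1 - 4 * x ∧
      y = (1 + x) * ((i : ℕ) + 1) - x * (k + 5)
  | right i, false, x, y => y = (i : ℕ) + 1 ∧ (i : ℕ) + 1 ≤ x ∧ x ≤ k + 2
  | right i, true, x, y => k + 2 ≤ x ∧ x ≤ k + 3 ∧ 0 ≤ y ∧ y ≤ (i : ℕ) + 1 ∧
      y = (k + 3 - x) * ((i : ℕ) + 1)
  | up i, false, x, y => x = (i : ℕ) + 1 ∧ (i : ℕ) + 1 ≤ y ∧ y ≤ k + 2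
  | up i, true, x, y => k + 2 ≤ y ∧ y ≤ k + 3 ∧ 0 ≤ x ∧ x ≤ (i : ℕ) + 1 ∧
      x = (k + 3 - y) * ((i : ℕ) + 1)
  | down i, false, x, y => x = (i : ℕ) + 1 ∧ 0 ≤ y ∧ y ≤ (i : ℕ) + 1
  | down i, true, x, y => -1 ≤ y ∧ y ≤ 0 ∧ 0 ≤ x ∧ x ≤ (i : ℕ) + 1 ∧ x = (1 + y) * ((i : ℕ) + 1)
  | wn, false, x, y => y = k + 3 - 2 * x ∧ -1 ≤ x ∧ x ≤ -1 / 2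
  | wn, true, x, y => y = k + 3 - 2 * x ∧ -1 / 2 ≤ x ∧ x ≤ 0
  | ne, false, x, y => y = x + k + 3 ∧ 0 ≤ x ∧ x ≤ 2 * k + 6
  | ne, true, x, y => y = 3 * (x - k - 3) ∧ k + 3 ≤ x ∧ x ≤ 2 * k + 6
  | se, false, x, y => y = -1 - x ∧ 0 ≤ x ∧ x ≤ 2 * k + 7
  | se, true, x, y => y = -2 * (x - k - 3) ∧ k + 3 ≤ x ∧ x ≤ 2 * k + 7
  | ws, false, x, y => y = k + 5 + 2 * (x + 1) ∧ -k - 8 ≤ x ∧ x ≤ -1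
  | ws, true, x, y => y = x - 1 ∧ -k - 8 ≤ x ∧ x ≤ 0
  | we, false, x, y => y = x + k + 6 ∧ -1 ≤ x ∧ x ≤ 3 * k + 12
  | we, true, x, y => y = 2 * (x - k - 3) ∧ k + 3 ≤ x ∧ x ≤ 3 * k + 12

theorem cast_fin_le (i : Fin (k + 1)) : 0 ≤ ((i : ℕ) : ℝ) ∧ ((i : ℕ) : ℝ) ≤ k :=
  ⟨Nat.cast_nonneg _, by exact_mod_cast Nat.lt_succ_iff.1 i.2⟩

theorem cast_fin_add_one_le (i : Fin k) : 0 ≤ ((i : ℕ) : ℝ) ∧ ((i : ℕ) : ℝ) + 1 ≤ k :=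
  ⟨Nat.cast_nonneg _, by exact_mod_cast i.2⟩

theorem region_of_mem_segment (a : Arc k) (b : Bool) {x : ℝ × ℝ}
    (h : x ∈ segment ℝ ((a.fin b).X, (a.fin b).Y) (a.X, a.Y)) : a.Region b x.1 x.2 := by
  obtain ⟨s, t, hs, ht, hst, rfl⟩ := h
  obtain rfl : s = 1 - t := by linarith
  have hk : (0 : ℝ) ≤ k := Nat.cast_nonneg _
  have e1 := mul_nonneg hs hk
  have e2 := mul_nonneg ht hk
  cases a with
  | path i =>
    cases b <;>
      simp only [Region, fin, Vert.X, Vert.Y, X, Y, Prod.smul_mk, Prod.mk_add_mk, smul_eq_mul,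
        Fin.val_castSucc, Fin.val_succ, Nat.cast_add, Nat.cast_one] <;>
      refine ⟨?_, ?_, ?_⟩ <;> first | trivial | linarith
  | left i | right i | up i | down i =>
    obtain ⟨h0, h1⟩ := cast_fin_le i
    have e3 := mul_nonneg hs h0
    have e4 := mul_nonneg ht h0
    have e5 := mul_nonneg hs (sub_nonneg.2 h1)
    have e6 := mul_nonneg ht (sub_nonneg.2 h1)
    cases b <;>
      simp only [Region, fin, Vert.X, Vert.Y, X, Y, Prod.smul_mk, Prod.mk_add_mk, smul_eq_mul] <;>
      refine ⟨?_, ?_⟩ <;> (try refine ⟨?_, ?_⟩) <;> (try refine ⟨?_, ?_⟩) <;>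
      (try refine ⟨?_, ?_⟩) <;> linarith
  | wn | ne | se | ws | we =>
    cases b <;>
      simp only [Region, fin, Vert.X, Vert.Y, X, Y, Prod.smul_mk, Prod.mk_add_mk, smul_eq_mul] <;>
      refine ⟨?_, ?_, ?_⟩ <;> linarith

theorem region_vert (a : Arc k) (b : Bool) (v : Vert k) (h : a.Region b v.X v.Y) :
    ∃ b', v = a.fin b' := by
  have hk : (0 : ℝ) ≤ k := Nat.cast_nonneg _
  suffices H : v ≠ a.fin false → v ≠ a.fin true → False by
    by_contra! hcon
    exact H (hcon _) (hcon _)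
  intro h0 h1
  cases v with
  | diag j =>
    obtain ⟨hj0, hj1⟩ := cast_fin_le j
    cases a with
    | path i =>
      simp only [fin, ne_eq, Vert.diag.injEq, Fin.ext_iff, Fin.val_castSucc, Fin.val_succ] at h0 h1
      obtain h2 | h2 : (j : ℕ) + 1 ≤ i ∨ (i : ℕ) + 2 ≤ j := by omega
      all_goals
        rify at h2
        cases b <;> simp only [Region, Vert.X, Vert.Y] at h <;> linarith
    | left i | right i | up i | down i =>
      obtain ⟨hi0, hi1⟩ := cast_fin_le i
      simp only [fin, ne_eq, Vert.diag.injEq, Fin.ext_iff] at h0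
      rcases lt_or_gt_of_ne h0 with h2 | h2 <;> rify at h2 <;>
      cases b <;> simp only [Region, Vert.X, Vert.Y] at h <;> linarith
    | wn | ne | se | ws | we =>
      cases b <;> simp only [Region, Vert.X, Vert.Y] at h <;> linarith
  | _ =>
    cases a with
    | path i =>
      obtain ⟨hi0, hi1⟩ := cast_fin_add_one_le i
      cases b <;> simp only [Region, Vert.X, Vert.Y] at h <;> linarith
    | left i | right i | up i | down i =>
      obtain ⟨hi0, hi1⟩ := cast_fin_le i
      cases b <;> simp only [Region, Vert.X, Vert.Y, fin, ne_eq, not_true] at h h0 h1 <;> linarith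
    | _ =>
      cases b <;> simp only [Region, Vert.X, Vert.Y, fin, ne_eq, not_true] at h h0 h1 <;> linarith

end Arc

end FourPoles

/-! ### Pairwise intersections of the edges. -/

namespace FourPoles

variable {k : ℕ}

namespace Arc

open Vert

theorem eq_bend_of_region (a : Arc k) {x y : ℝ} (h0 : a.Region false x y)
    (h1 : a.Region true x y) : x = a.X ∧ y = a.Y := by
  cases a <;> simp only [Region, X, Y] at h0 h1 ⊢ <;> constructor <;> linarith

/-- At `(x, y)`, a horizontal segment of `a` and a vertical segment of `b` cross, if they meet. -/
def CrossAt (a : Arc k) (s : Bool) (b : Arc k) (t : Bool) (x y : ℝ) : Prop :=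
  (a.fin s).Y = a.Y ∧ (b.fin t).X = b.X ∧ x ≠ (a.fin s).X ∧ x ≠ a.X ∧ y ≠ (b.fin t).Y ∧ y ≠ b.Y

/-- The edges `a` and `b` are allowed to meet in `(x, y)`. -/
def Meets (a : Arc k) (s : Bool) (b : Arc k) (t : Bool) (x y : ℝ) : Prop :=
  (∃ s' t', a.fin s' = b.fin t' ∧ x = (a.fin s').X ∧ y = (a.fin s').Y) ∨
    CrossAt a s b t x y ∨ CrossAt b t a s x y

theorem Meets.symm {a b : Arc k} {s t : Bool} {x y : ℝ} (h : Meets a s b t x y) :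
    Meets b t a s x y := by
  rcases h with ⟨s', t', h1, h2, h3⟩ | h | h
  · exact Or.inl ⟨t', s', h1.symm, by rw [← h1]; exact h2, by rw [← h1]; exact h3⟩
  · exact Or.inr (Or.inr h)
  · exact Or.inr (Or.inl h)

theorem add_one_le_cast {m n : ℕ} (i : Fin m) (j : Fin n) (h : (i : ℕ) < j) :
    ((i : ℕ) : ℝ) + 1 ≤ (j : ℕ) := by
  exact_mod_cast h

theorem meets_path_path {i j : Fin k} (hij : i < j) {s t : Bool} {x y : ℝ}
    (h1 : (path i).Region s x y) (h2 : (path j).Region t x y) :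
    Meets (path i) s (path j) t x y := by
  have h3 := add_one_le_cast i j hij
  cases s <;> cases t <;> simp only [Region] at h1 h2 <;> try linarith
  have h4 : (j : ℕ) = i + 1 := by
    have : ((j : ℕ) : ℝ) ≤ (i : ℕ) + 1 := by linarith
    have : (j : ℕ) ≤ i + 1 := by exact_mod_cast this
    have : (i : ℕ) < j := hij
    omega
  refine Or.inl ⟨true, false, ?_, ?_⟩
  · simp [fin, Fin.ext_iff, h4]
  · rify at h4
    simp only [fin, Vert.X, Vert.Y, Fin.val_succ, Nat.cast_add, Nat.cast_one]
    constructor <;> linarith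

theorem meets_path_port {i : Fin k} {b : Arc k} {j : Fin (k + 1)} {s t : Bool} {x y : ℝ}
    (hb : b = left j ∨ b = right j ∨ b = up j ∨ b = down j)
    (h1 : (path i).Region s x y) (h2 : b.Region t x y) :
    Meets (path i) s b t x y := by
  obtain ⟨hi0, hi1⟩ := cast_fin_add_one_le i
  obtain ⟨hj0, hj1⟩ := cast_fin_le j
  have key : (j : ℕ) + 1 ≤ i ∨ j = i.castSucc ∨ j = i.succ ∨ (i : ℕ) + 2 ≤ j := by
    simp only [Fin.ext_iff, Fin.val_castSucc, Fin.val_succ]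
    omega
  rcases key with h3 | rfl | rfl | h3
  · rify at h3
    rcases hb with rfl | rfl | rfl | rfl <;> cases s <;> cases t <;> simp only [Region] at h1 h2 <;>
      linarith
  · simp only [Fin.val_castSucc] at hj0 hj1
    rcases hb with rfl | rfl | rfl | rfl <;> cases s <;> cases t <;>
      simp only [Region, Fin.val_castSucc] at h1 h2 <;> first
      | linarith
      | refine Or.inl ⟨false, false, rfl, ?_⟩
        simp only [fin, Vert.X, Vert.Y, Fin.val_castSucc]
        constructor <;> linarith
  · simp only [Fin.val_succ, Nat.cast_add, Nat.cast_one] at hj0 hj1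
    rcases hb with rfl | rfl | rfl | rfl <;> cases s <;> cases t <;>
      simp only [Region, Fin.val_succ, Nat.cast_add, Nat.cast_one] at h1 h2 <;> first
      | linarith
      | refine Or.inl ⟨true, false, rfl, ?_⟩
        simp only [fin, Vert.X, Vert.Y, Fin.val_succ, Nat.cast_add, Nat.cast_one]
        constructor <;> linarith
  · rify at h3
    rcases hb with rfl | rfl | rfl | rfl <;> cases s <;> cases t <;> simp only [Region] at h1 h2 <;>
      linarith

/-- The edges between two poles. -/
def IsPolar : Arc k → Prop
  | wn | ne | se | ws | we => True
  | _ => False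

theorem meets_path_polar {i : Fin k} {b : Arc k} {s t : Bool} {x y : ℝ} (hb : b.IsPolar)
    (h1 : (path i).Region s x y) (h2 : b.Region t x y) : Meets (path i) s b t x y := by
  obtain ⟨hi0, hi1⟩ := cast_fin_add_one_le i
  cases b <;> simp only [IsPolar] at hb <;> cases s <;> cases t <;> simp only [Region] at h1 h2 <;>
    linarith

theorem meets_polar_polar {a b : Arc k} {s t : Bool} {x y : ℝ} (ha : a.IsPolar) (hb : b.IsPolar)
    (hab : a ≠ b) (h1 : a.Region s x y) (h2 : b.Region t x y) : Meets a s b t x y := by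
  have hk : (0 : ℝ) ≤ k := Nat.cast_nonneg _
  cases a <;> simp only [IsPolar] at ha <;> cases b <;> simp only [IsPolar] at hb <;>
    (first | exact absurd rfl hab | skip) <;>
    cases s <;> cases t <;> simp only [Region] at h1 h2 <;> first
    | linarith
    | refine Or.inl ⟨false, false, rfl, ?_⟩
      simp only [fin, Vert.X, Vert.Y]
      constructor <;> linarith
    | refine Or.inl ⟨false, true, rfl, ?_⟩
      simp only [fin, Vert.X, Vert.Y]
      constructor <;> linarith
    | refine Or.inl ⟨true, false, rfl, ?_⟩
      simp only [fin, Vert.X, Vert.Y]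
      constructor <;> linarith
    | refine Or.inl ⟨true, true, rfl, ?_⟩
      simp only [fin, Vert.X, Vert.Y]
      constructor <;> linarith

theorem meets_port_polar {a b : Arc k} {i : Fin (k + 1)} {s t : Bool} {x y : ℝ}
    (ha : a = left i ∨ a = right i ∨ a = up i ∨ a = down i) (hb : b.IsPolar)
    (h1 : a.Region s x y) (h2 : b.Region t x y) : Meets a s b t x y := by
  have hk : (0 : ℝ) ≤ k := Nat.cast_nonneg _
  obtain ⟨hi0, hi1⟩ := cast_fin_le i
  rcases ha with rfl | rfl | rfl | rfl <;> cases b <;> simp only [IsPolar] at hb <;>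
    cases s <;> cases t <;> simp only [Region] at h1 h2 <;> first
    | linarith
    | refine Or.inl ⟨true, false, rfl, ?_⟩
      simp only [fin, Vert.X, Vert.Y]
      constructor <;> linarith
    | refine Or.inl ⟨true, true, rfl, ?_⟩
      simp only [fin, Vert.X, Vert.Y]
      constructor <;> linarith

theorem meets_port_port_self {a b : Arc k} {i : Fin (k + 1)} {s t : Bool} {x y : ℝ} (hab : a ≠ b)
    (ha : a = left i ∨ a = right i ∨ a = up i ∨ a = down i)
    (hb : b = left i ∨ b = right i ∨ b = up i ∨ b = down i)
    (h1 : a.Region s x y) (h2 : b.Region t x y) : Meets a s b t x y := by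
  have hk : (0 : ℝ) ≤ k := Nat.cast_nonneg _
  obtain ⟨hi0, hi1⟩ := cast_fin_le i
  rcases ha with rfl | rfl | rfl | rfl <;> rcases hb with rfl | rfl | rfl | rfl <;>
    (first | exact absurd rfl hab | skip) <;>
    cases s <;> cases t <;> simp only [Region] at h1 h2 <;> first
    | linarith
    | refine Or.inl ⟨false, false, rfl, ?_⟩
      simp only [fin, Vert.X, Vert.Y]
      constructor <;> linarith

/-- The straight parts are parallel and distinct, and the slanted parts belong to a pencil of lines
through the pole. -/
theorem meets_same_port {i j : Fin (k + 1)} (hij : i < j) {s t : Bool} {x y : ℝ}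
    {c : Fin (k + 1) → Arc k} (hc : c = left ∨ c = right ∨ c = up ∨ c = down)
    (h1 : (c i).Region s x y) (h2 : (c j).Region t x y) : Meets (c i) s (c j) t x y := by
  have h3 := add_one_le_cast i j hij
  -- Here `u` is the distance to the pole in one coordinate; two lines of the pencil with different
  -- indices agree only where it vanishes.
  have hpole : ∀ u v w : ℝ, 0 ≤ u → v = u * ((i : ℕ) + 1) + w → v = u * ((j : ℕ) + 1) + w → u = 0 := by
    intro u v w hu e1 e2
    have e3 : u * ((j : ℕ) - (i : ℕ) : ℝ) = 0 := by linear_combination e1 - e2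
    exact (mul_eq_zero.1 e3).resolve_right (by linarith)
  rcases hc with rfl | rfl | rfl | rfl
  · cases s <;> cases t <;> simp only [Region] at h1 h2 <;> first
      | linarith
      | have hpt : x = 0 := by linarith
        subst hpt
        linarith
      | have := hpole (1 + x) y (-(x * (k + 5))) (by linarith) (by linarith) (by linarith)
        have hpt : x = -1 := by linarith
        subst hpt
        refine Or.inl ⟨true, true, rfl, ?_⟩
        simp only [fin, Vert.X, Vert.Y]
        constructor <;> first | trivial | linarith
  · cases s <;> cases t <;> simp only [Region] at h1 h2 <;> first
      | linarith
      | have hpt : x = k + 2 := by linarith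
        subst hpt
        linarith
      | have := hpole (k + 3 - x) y (0) (by linarith) (by linarith) (by linarith)
        have hpt : x = k + 3 := by linarith
        subst hpt
        refine Or.inl ⟨true, true, rfl, ?_⟩
        simp only [fin, Vert.X, Vert.Y]
        constructor <;> first | trivial | linarith
  · cases s <;> cases t <;> simp only [Region] at h1 h2 <;> first
      | linarith
      | have hpt : y = k + 2 := by linarith
        subst hpt
        linarith
      | have := hpole (k + 3 - y) x (0) (by linarith) (by linarith) (by linarith)
        have hpt : y = k + 3 := by linarith
        subst hpt
        refine Or.inl ⟨true, true, rfl, ?_⟩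
        simp only [fin, Vert.X, Vert.Y]
        constructor <;> first | trivial | linarith
  · cases s <;> cases t <;> simp only [Region] at h1 h2 <;> first
      | linarith
      | have hpt : y = 0 := by linarith
        subst hpt
        linarith
      | have := hpole (1 + y) x (0) (by linarith) (by linarith) (by linarith)
        have hpt : y = -1 := by linarith
        subst hpt
        refine Or.inl ⟨true, true, rfl, ?_⟩
        simp only [fin, Vert.X, Vert.Y]
        constructor <;> first | trivial | linarith

/-- For `i < j`, the only proper crossings are `right i` with `down j` and `up i` with `left j`. -/
theorem meets_port_port {a b : Arc k} {i j : Fin (k + 1)} (hij : i < j) {s t : Bool} {x y : ℝ}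
    (ha : a = left i ∨ a = right i ∨ a = up i ∨ a = down i)
    (hb : b = left j ∨ b = right j ∨ b = up j ∨ b = down j)
    (h1 : a.Region s x y) (h2 : b.Region t x y) : Meets a s b t x y := by
  have h3 := add_one_le_cast i j hij
  have hk : (0 : ℝ) ≤ k := Nat.cast_nonneg _
  obtain ⟨hi0, hi1⟩ := cast_fin_le i
  obtain ⟨hj0, hj1⟩ := cast_fin_le j
  have ne : ∀ u v : ℝ, u < v ∨ v < u → u ≠ v := fun u v h => h.elim ne_of_lt ne_of_gt
  rcases ha with rfl | rfl | rfl | rfl <;> rcases hb with rfl | rfl | rfl | rfl <;>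
    (first
      | exact meets_same_port hij (Or.inl rfl) h1 h2
      | exact meets_same_port hij (Or.inr (Or.inl rfl)) h1 h2
      | exact meets_same_port hij (Or.inr (Or.inr (Or.inl rfl))) h1 h2
      | exact meets_same_port hij (Or.inr (Or.inr (Or.inr rfl))) h1 h2
      | skip) <;>
    cases s <;> cases t <;> simp only [Region] at h1 h2 <;> first
    | linarith
    | refine Or.inr (Or.inl ⟨rfl, rfl, ?_, ?_, ?_, ?_⟩) <;>
        simp only [fin, Vert.X, Vert.Y, X, Y] <;> intro h <;> linarith
    | refine Or.inr (Or.inr ⟨rfl, rfl, ?_, ?_, ?_, ?_⟩) <;>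
        simp only [fin, Vert.X, Vert.Y, X, Y] <;> intro h <;> linarith

theorem path_or_port_or_polar (a : Arc k) : (∃ i, a = path i) ∨
    (∃ i, a = left i ∨ a = right i ∨ a = up i ∨ a = down i) ∨ a.IsPolar := by
  cases a <;> simp [IsPolar]

theorem meets_of_region {a b : Arc k} (hab : a ≠ b) {s t : Bool} {x y : ℝ}
    (h1 : a.Region s x y) (h2 : b.Region t x y) : Meets a s b t x y := by
  rcases a.path_or_port_or_polar with ⟨i, rfl⟩ | ⟨i, ha⟩ | ha <;>
    rcases b.path_or_port_or_polar with ⟨j, rfl⟩ | ⟨j, hb⟩ | hb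
  · rcases lt_trichotomy i j with hij | rfl | hij
    · exact meets_path_path hij h1 h2
    · exact absurd rfl hab
    · exact (meets_path_path hij h2 h1).symm
  · exact meets_path_port hb h1 h2
  · exact meets_path_polar hb h1 h2
  · exact (meets_path_port ha h2 h1).symm
  · rcases lt_trichotomy i j with hij | rfl | hij
    · exact meets_port_port hij ha hb h1 h2
    · exact meets_port_port_self hab ha hb h1 h2
    · exact (meets_port_port hij hb ha h2 h1).symm
  · exact meets_port_polar ha hb h1 h2
  · exact (meets_path_polar ha h2 h1).symm
  · exact (meets_port_polar hb ha h2 h1).symm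
  · exact meets_polar_polar ha hb hab h1 h2

end Arc

end FourPoles

/-! ### The graph and its drawing. -/

namespace FourPoles

variable {k : ℕ}

namespace Vert

/-- The position of a vertex. -/
noncomputable def pos (v : Vert k) : ℝ × ℝ := (v.X, v.Y)

theorem pos_injective : Function.Injective (pos : Vert k → ℝ × ℝ) := by
  intro v w h
  have hk : (0 : ℝ) ≤ k := Nat.cast_nonneg _
  obtain ⟨hx, hy⟩ := Prod.mk.injEq .. ▸ h
  cases v <;> cases w <;> simp only [X, Y] at hx hy <;> first
    | rfl
    | linarith
    | skip
  · rename_i i j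
    congr 1
    refine Fin.ext ?_
    have : ((i : ℕ) : ℝ) = (j : ℕ) := by linarith
    exact_mod_cast this

end Vert

namespace Arc

/-- The position of the bend of an edge. -/
noncomputable def bend (a : Arc k) : ℝ × ℝ := (a.X, a.Y)

theorem bend_ne_pos (a : Arc k) (b : Bool) : (a.fin b).pos ≠ a.bend := by
  intro h
  have hk : (0 : ℝ) ≤ k := Nat.cast_nonneg _
  obtain ⟨hx, hy⟩ := Prod.mk.injEq .. ▸ h
  cases a with
  | path i =>
    cases b <;>
      simp only [fin, Vert.X, X, Fin.val_castSucc, Fin.val_succ, Nat.cast_add, Nat.cast_one] at hx <;>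
      linarith
  | left i | right i | up i | down i =>
    have := cast_fin_le i
    cases b <;> simp only [fin, Vert.X, Vert.Y, X, Y] at hx hy <;> linarith
  | _ => cases b <;> simp only [fin, Vert.X, Vert.Y, X, Y] at hx hy <;> linarith

theorem fin_false_ne_fin_true (a : Arc k) : a.fin false ≠ a.fin true := by
  cases a <;> simp [fin, Fin.ext_iff]

/-- The pair of end vertices of an edge. -/
def ends (a : Arc k) : Sym2 (Vert k) := s(a.fin false, a.fin true)

theorem fin_mem_ends (a : Arc k) (b : Bool) : a.fin b ∈ a.ends := by
  cases b <;> simp [ends]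

theorem ends_injective : Function.Injective (ends : Arc k → Sym2 (Vert k)) := by
  intro a b h
  cases a <;> cases b <;> simp [ends, fin, Fin.ext_iff] at h ⊢ <;> omega

variable {W : Type*} (φ : Vert k ≃ W)

/-- The graph of the drawing, on a set of vertices given by the bijection `φ`. -/
def graph : SimpleGraph W := SimpleGraph.fromEdgeSet (Set.range fun a : Arc k => a.ends.map φ)

theorem edgeSet_graph : (graph φ).edgeSet = Set.range fun a : Arc k => a.ends.map φ := by
  rw [graph, SimpleGraph.edgeSet_fromEdgeSet, sdiff_eq_left, Set.disjoint_left]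
  rintro _ ⟨a, rfl⟩ h
  exact a.fin_false_ne_fin_true (by simpa [ends] using h)

theorem ncard_edgeSet_graph : (graph φ).edgeSet.ncard = 5 * k + 9 := by
  have hinj : Function.Injective fun a : Arc k => a.ends.map φ :=
    (Sym2.map.injective φ.injective).comp ends_injective
  rw [edgeSet_graph, ← Set.image_univ, Set.ncard_image_of_injective _ hinj, Set.ncard_univ,
    Nat.card_congr equivSum]
  simp
  ring

theorem exists_arc (e : (graph φ).edgeSet) : ∃ a : Arc k, a.ends.map φ = e :=
  (Set.ext_iff.1 (edgeSet_graph φ) e).1 e.2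

/-- The arc of the drawing that represents an edge of the graph. -/
noncomputable def ofEdge (e : (graph φ).edgeSet) : Arc k := (exists_arc φ e).choose

theorem ends_ofEdge (e : (graph φ).edgeSet) : (ofEdge φ e).ends.map φ = e :=
  (exists_arc φ e).choose_spec

theorem ofEdge_ne {e f : (graph φ).edgeSet} (h : e ≠ f) : ofEdge φ e ≠ ofEdge φ f := fun h' =>
  h (Subtype.ext (by rw [← ends_ofEdge φ e, ← ends_ofEdge φ f, h']))

theorem fin_mem_edge (e : (graph φ).edgeSet) (b : Bool) :
    φ ((ofEdge φ e).fin b) ∈ (e : Sym2 W) := by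
  rw [← ends_ofEdge φ e]
  exact Sym2.mem_map.2 ⟨_, fin_mem_ends _ b, rfl⟩

/-- The corners of the polyline of an edge. -/
noncomputable def corner (a : Arc k) : Fin 3 → ℝ × ℝ :=
  ![(a.fin false).pos, a.bend, (a.fin true).pos]

/-- The end of an edge at which its `i`-th segment ends. -/
def side (i : Fin 2) : Bool := decide (i = 1)

theorem corner_eq (a : Arc k) (i : Fin 2) :
    (a.corner i.castSucc = (a.fin (side i)).pos ∧ a.corner i.succ = a.bend) ∨
      (a.corner i.castSucc = a.bend ∧ a.corner i.succ = (a.fin (side i)).pos) := by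
  fin_cases i
  · exact Or.inl ⟨rfl, rfl⟩
  · exact Or.inr ⟨rfl, rfl⟩

theorem segment_corner (a : Arc k) (i : Fin 2) :
    segment ℝ (a.corner i.castSucc) (a.corner i.succ) =
      segment ℝ (a.fin (side i)).pos a.bend := by
  rcases a.corner_eq i with ⟨h1, h2⟩ | ⟨h1, h2⟩
  · rw [h1, h2]
  · rw [h1, h2, segment_symm]

theorem openSegment_corner (a : Arc k) (i : Fin 2) :
    openSegment ℝ (a.corner i.castSucc) (a.corner i.succ) =
      openSegment ℝ (a.fin (side i)).pos a.bend := by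
  rcases a.corner_eq i with ⟨h1, h2⟩ | ⟨h1, h2⟩
  · rw [h1, h2]
  · rw [h1, h2, openSegment_symm]

theorem corner_ne (a : Arc k) (i : Fin 2) : a.corner i.castSucc ≠ a.corner i.succ := by
  rcases a.corner_eq i with ⟨h1, h2⟩ | ⟨h1, h2⟩
  · rw [h1, h2]
    exact a.bend_ne_pos _
  · rw [h1, h2]
    exact (a.bend_ne_pos _).symm

theorem region_of_mem (a : Arc k) (i : Fin 2) {x : ℝ × ℝ}
    (h : x ∈ segment ℝ (a.corner i.castSucc) (a.corner i.succ)) : a.Region (side i) x.1 x.2 := by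
  rw [segment_corner] at h
  exact region_of_mem_segment a _ h

theorem snd_eq_of_horizontal {a : Arc k} {i : Fin 2} (h : (a.fin (side i)).Y = a.Y) :
    (a.corner i.castSucc).2 = (a.corner i.succ).2 := by
  rcases a.corner_eq i with ⟨h1, h2⟩ | ⟨h1, h2⟩
  · rw [h1, h2]
    exact h
  · rw [h1, h2]
    exact h.symm

theorem fst_eq_of_vertical {a : Arc k} {i : Fin 2} (h : (a.fin (side i)).X = a.X) :
    (a.corner i.castSucc).1 = (a.corner i.succ).1 := by
  rcases a.corner_eq i with ⟨h1, h2⟩ | ⟨h1, h2⟩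
  · rw [h1, h2]
    exact h
  · rw [h1, h2]
    exact h.symm

theorem mem_openSegment_of_ne {a : Arc k} {i : Fin 2} {x : ℝ × ℝ}
    (hx : x ∈ segment ℝ (a.corner i.castSucc) (a.corner i.succ))
    (h1 : x ≠ (a.fin (side i)).pos) (h2 : x ≠ a.bend) :
    x ∈ openSegment ℝ (a.corner i.castSucc) (a.corner i.succ) := by
  rw [segment_corner] at hx
  rw [openSegment_corner]
  exact mem_openSegment_of_ne_left_right h1.symm h2.symm hx

/-- A vertex is not interior to a segment. -/
theorem pos_notMem_openSegment (a : Arc k) (i : Fin 2) (v : Vert k) :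
    v.pos ∉ openSegment ℝ (a.corner i.castSucc) (a.corner i.succ) := by
  intro h
  obtain ⟨b, rfl⟩ := a.region_vert _ v (a.region_of_mem i (openSegment_subset_segment _ _ _ h))
  rw [openSegment_corner] at h
  by_cases hb : b = side i
  · rw [hb, left_mem_openSegment_iff] at h
    exact a.bend_ne_pos _ h
  · have h1 : a.Region (side i) (a.fin b).X (a.fin b).Y :=
      region_of_mem_segment a _ (openSegment_subset_segment _ _ _ h)
    have h2 : a.Region b (a.fin b).X (a.fin b).Y :=
      region_of_mem_segment a b (left_mem_segment _ _ _)
    -- The end at the far side would lie on both segments of the edge, hence be the bend.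
    have h3 : (a.fin b).pos = a.bend := by
      cases b
      · have hs : side i = true := by simpa using Ne.symm hb
        rw [hs] at h1
        exact Prod.ext (a.eq_bend_of_region h2 h1).1 (a.eq_bend_of_region h2 h1).2
      · have hs : side i = false := by simpa using Ne.symm hb
        rw [hs] at h1
        exact Prod.ext (a.eq_bend_of_region h1 h2).1 (a.eq_bend_of_region h1 h2).2
    exact a.bend_ne_pos b h3

/-- Two segments of distinct edges meet only at common ends and at axis-parallel crossings. -/
theorem common_end_or_crossing {a b : Arc k} (hab : a ≠ b) (i j : Fin 2) {x : ℝ × ℝ}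
    (hx : x ∈ segment ℝ (a.corner i.castSucc) (a.corner i.succ))
    (hx' : x ∈ segment ℝ (b.corner j.castSucc) (b.corner j.succ)) :
    (∃ s t, a.fin s = b.fin t ∧ x = (a.fin s).pos) ∨
      (x ∈ openSegment ℝ (a.corner i.castSucc) (a.corner i.succ) ∧
        x ∈ openSegment ℝ (b.corner j.castSucc) (b.corner j.succ) ∧
        ((a.corner i.castSucc).2 = (a.corner i.succ).2 ∧
            (b.corner j.castSucc).1 = (b.corner j.succ).1 ∨
          (a.corner i.castSucc).1 = (a.corner i.succ).1 ∧
            (b.corner j.castSucc).2 = (b.corner j.succ).2)) := by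
  rcases meets_of_region hab (a.region_of_mem i hx) (b.region_of_mem j hx') with
    ⟨s, t, h1, h2, h3⟩ | ⟨h1, h2, h3, h4, h5, h6⟩ | ⟨h1, h2, h3, h4, h5, h6⟩
  · exact Or.inl ⟨s, t, h1, Prod.ext h2 h3⟩
  · exact Or.inr ⟨mem_openSegment_of_ne hx (fun h => h3 (by rw [h]; rfl))
      (fun h => h4 (by rw [h]; rfl)), mem_openSegment_of_ne hx' (fun h => h5 (by rw [h]; rfl))
      (fun h => h6 (by rw [h]; rfl)), Or.inl ⟨snd_eq_of_horizontal h1, fst_eq_of_vertical h2⟩⟩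
  · exact Or.inr ⟨mem_openSegment_of_ne hx (fun h => h5 (by rw [h]; rfl))
      (fun h => h6 (by rw [h]; rfl)), mem_openSegment_of_ne hx' (fun h => h3 (by rw [h]; rfl))
      (fun h => h4 (by rw [h]; rfl)), Or.inr ⟨fst_eq_of_vertical h2, snd_eq_of_horizontal h1⟩⟩

/-- The drawing of the graph. -/
noncomputable def drawing : PolylineDrawing (graph φ) where
  pos w := (φ.symm w).pos
  pos_injective := Vert.pos_injective.comp φ.symm.injective
  src e := φ ((ofEdge φ e).fin false)
  tgt e := φ ((ofEdge φ e).fin true)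
  edge_eq e := (ends_ofEdge φ e).symm
  numBends _ := 1
  pt e := (ofEdge φ e).corner
  pt_zero e := by simp [corner]
  pt_last e := by simp [corner, Fin.last]
  pt_ne e i := corner_ne _ i
  simple e i j hij x hx hx' := by
    obtain ⟨rfl, rfl⟩ : i = 0 ∧ j = 1 := by
      have h1 := i.2
      have h2 := j.2
      have h3 : (i : ℕ) < j := hij
      exact ⟨Fin.ext (by simp; omega), Fin.ext (by simp; omega)⟩
    have h := eq_bend_of_region _ (region_of_mem _ _ hx) (region_of_mem _ _ hx')
    exact ⟨rfl, Prod.ext h.1 h.2⟩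
  vertex_mem e i v hv := by
    obtain ⟨b, hb⟩ := region_vert _ _ _ (region_of_mem _ _ hv)
    rw [Equiv.symm_apply_eq] at hb
    rw [hb]
    exact fin_mem_edge φ e b
  inter e f hef i j x hx hx' := by
    rcases common_end_or_crossing (ofEdge_ne φ hef) i j hx hx' with ⟨s, t, h1, h2⟩ | ⟨h1, h2, h3⟩
    · exact Or.inl ⟨_, fin_mem_edge φ e s, h1 ▸ fin_mem_edge φ f t, by simpa using h2⟩
    · refine Or.inr ⟨h1, h2, ?_⟩
      have he := corner_ne (ofEdge φ e) i
      have hf := corner_ne (ofEdge φ f) j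
      rcases h3 with ⟨h3, h4⟩ | ⟨h3, h4⟩
      · rw [h3, h4, sub_self, zero_mul]
        exact mul_ne_zero (sub_ne_zero.2 fun h => he (Prod.ext h.symm h3))
          (sub_ne_zero.2 fun h => hf (Prod.ext h4 h.symm))
      · rw [h3, h4, sub_self, zero_mul]
        exact (mul_ne_zero (sub_ne_zero.2 fun h => he (Prod.ext h3 h.symm))
          (sub_ne_zero.2 fun h => hf (Prod.ext h.symm h4))).symm

theorem isBendApRAC_graph : IsBendApRAC 1 (graph φ) := by
  have key : ∀ e f i j, (drawing φ).Crosses e f i j →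
      ((ofEdge φ e).corner (Fin.castSucc i)).2 = ((ofEdge φ e).corner i.succ).2 ∧
          ((ofEdge φ f).corner (Fin.castSucc j)).1 = ((ofEdge φ f).corner j.succ).1 ∨
        ((ofEdge φ e).corner (Fin.castSucc i)).1 = ((ofEdge φ e).corner i.succ).1 ∧
          ((ofEdge φ f).corner (Fin.castSucc j)).2 = ((ofEdge φ f).corner j.succ).2 := by
    rintro e f i j ⟨hef, x, hx, hx'⟩
    rcases common_end_or_crossing (ofEdge_ne φ hef) i j (openSegment_subset_segment _ _ _ hx)
      (openSegment_subset_segment _ _ _ hx') with ⟨s, t, -, rfl⟩ | ⟨-, -, h3⟩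
    -- `Crosses` does not by itself exclude a common end vertex; it is excluded because no vertex is
    -- interior to a segment.
    · exact absurd hx (pos_notMem_openSegment _ _ _)
    · exact h3
  refine ⟨drawing φ, fun _ => le_rfl, fun e f i j h => ?_, fun e f i j h => ?_⟩
  · rcases key e f i j h with ⟨h1, h2⟩ | ⟨h1, h2⟩
    · change _ * (((ofEdge φ f).corner j.succ).1 - ((ofEdge φ f).corner (Fin.castSucc j)).1) +
        (((ofEdge φ e).corner i.succ).2 - ((ofEdge φ e).corner (Fin.castSucc i)).2) * _ = 0
      rw [h1, h2]
      ring
    · change (((ofEdge φ e).corner i.succ).1 - ((ofEdge φ e).corner (Fin.castSucc i)).1) * _ +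
        _ * (((ofEdge φ f).corner j.succ).2 - ((ofEdge φ f).corner (Fin.castSucc j)).2) = 0
      rw [h1, h2]
      ring
  · rcases key e f i j h with ⟨h1, h2⟩ | ⟨h1, h2⟩
    · exact ⟨Or.inl h1, Or.inr h2⟩
    · exact ⟨Or.inr h1, Or.inl h2⟩

end Arc

end FourPoles

theorem mainTheorem4 :
    (∀ (V : Type*) [Fintype V] (G : SimpleGraph V), 2 ≤ Fintype.card V → IsBendApRAC 1 G →
      (G.edgeSet.ncard : ℤ) ≤ 5 * (Fintype.card V : ℤ) - 8) ∧
    (∀ N : ℕ, ∃ n : ℕ, N ≤ n ∧ ∃ G : SimpleGraph (Fin n),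
      IsBendApRAC 1 G ∧ (G.edgeSet.ncard : ℤ) = 5 * (n : ℤ) - 16) := by
  refine ⟨fun V _ G hV ⟨D, hD, hA⟩ => ?_, fun N => ?_⟩
  · have := D.ncard_edgeSet_le hD hA hV
    omega
  -- Take `k = N`, so `n = N + 5` and `5N + 9 = 5n - 16`.
  · let φ : FourPoles.Vert N ≃ Fin (N + 1 + 4) := FourPoles.Vert.equivSum.trans finSumFinEquiv
    refine ⟨N + 1 + 4, by omega, FourPoles.Arc.graph φ, FourPoles.Arc.isBendApRAC_graph φ, ?_⟩
    rw [FourPoles.Arc.ncard_edgeSet_graph]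
    push_cast
    ring
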